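/- Work on $(0,\infty)$ with Lebesgue measure $m$; functions are real- or complex-valued and measurable, identified when equal almost everywhere. Let $L_0$ be the space of functions $f$ with $\|f\|_0:=m(\operatorname{supp} f)<\infty$, and for $0<r\le\infty$ let $L_r$ be the usual space with its (quasi-)norm $\|\cdot\|_r$. Let $\mu(t,f)=\inf\{s\ge 0: m(\{|f|>s\})\le t\}$ be the decreasing rearrangement. For $f,g\in L_1+L_\infty$ write $g\prec\prec_{\mathrm{hd}}f$ if $\int_0^t\mu(s,g)\,ds\le\int_0^t\mu(s,f)\,ds$ for all $t>0$; for $f,g\in L_0+L_1$ write $g\prec\prec_{\mathrm{tl}}f$ if $\int_t^\infty\mu(s,g)\,ds\le\int_t^\infty\mu(s,f)\,ds$ for all $t>0$ (these relations are understood to include that both functions lie in the indicated space). A quasi-Banach function space is a linear space $E$ of measurable functions with a complete quasi-norm $\|\cdot\|_E$ such that $f\in E$, $g$ measurable and $|g|\le|f|$ imply $g\in E$ and $\|g\|_E\le\|f\|_E$. For $0\le p<q\le\infty$, $E\in\mathrm{Int}(L_p,L_q)$ means that $L_p\cap L_q\subset E\subset L_p+L_q$ and every linear operator $T:L_p+L_q\to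 L_p+L_q$ which restricts to bounded operators $L_p\to L_p$ and $L_q\to L_q$ restricts to a bounded operator $E\to E$; here $T$ is bounded on $L_r$ if $T(L_r)\subset L_r$ and $\|Tf\|_r\le C\|f\|_r$ for some $C<\infty$ and all $f\in L_r$. Theorem. Let $0\le p<q\le\infty$ with either $p\ne 0$ or $q\ne\infty$, and let $E\ne\{0\}$ be a quasi-Banach function space. Assume that there exist constants $c_{p,E},c_{q,E}>0$ such that (i) if $p\neq 0$: for any $f\in E$ and $g\in L_p+L_\infty$, if $|g|^p\prec\prec_{\mathrm{hd}}|f|^p$, then $g\in E$ and $\|g\|_E\le c_{p,E}\|f\|_E$; (ii) if $q\neq\infty$: for any $f\in E$ and $g\in L_0+L_q$, if $|g|^q\prec\prec_{\mathrm{tl}}|f|^q$, then $g\in E$ and $\|g\|_E\le c_{q,E}\|f\|_E$. Then $E\in\mathrm{Int}(L_p,L_q)$. -/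

import Mathlib

open MeasureTheory Set Filter Topology
open scoped ENNReal NNReal

noncomputable section

section Definitions

variable {Ω : Type*} [MeasurableSpace Ω] {m : Measure Ω} {𝕜 : Type*} [RCLike 𝕜]

/-- The size functional of `L_r` for `r ∈ [0,∞]`: for `r = 0` it is the measure of the support,
for `r ∈ (0,∞]` it is the usual `L_r` (quasi-)norm. -/
def lGauge (r : ℝ≥0∞) (f : Ω →ₘ[m] 𝕜) : ℝ≥0∞ :=
  if r = 0 then m (Function.support f) else eLpNorm f r m

/-- The space `L_r`, `r ∈ [0,∞]`, as a linear subspace of the space of all measurable functions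
(modulo equality almost everywhere). `L_0` consists of the functions whose support has finite
measure. -/
def lSpace (𝕜 : Type*) [RCLike 𝕜] (m : Measure Ω) (r : ℝ≥0∞) : Submodule 𝕜 (Ω →ₘ[m] 𝕜) where
  carrier := {f | lGauge r f < ∞}
  zero_mem' := by
    by_cases hr : r = 0
    · have h : m (Function.support ((0 : Ω →ₘ[m] 𝕜) : Ω → 𝕜)) = 0 := by
        have h0 : ∀ᵐ x ∂m, (0 : Ω →ₘ[m] 𝕜) x = 0 := AEEqFun.coeFn_zero
        exact ae_iff.1 h0
      simp [lGauge, hr, h]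
    · have h : eLpNorm ((0 : Ω →ₘ[m] 𝕜) : Ω → 𝕜) r m = 0 := by
        rw [eLpNorm_congr_ae AEEqFun.coeFn_zero]
        exact eLpNorm_zero
      simp [lGauge, hr, h]
  add_mem' := by
    intro f g hf hg
    by_cases hr : r = 0
    · simp only [lGauge, hr, if_true, mem_ofPred_eq] at hf hg ⊢
      have h : Function.support ((f + g : Ω →ₘ[m] 𝕜) : Ω → 𝕜) ≤ᵐ[m]
          (Function.support f ∪ Function.support g : Set Ω) := by
        filter_upwards [AEEqFun.coeFn_add f g] with x hx hxs
        by_contra hcon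
        apply hxs
        have h1 : f x = 0 ∧ g x = 0 := by
          constructor
          · by_contra h2
            exact hcon (Or.inl h2)
          · by_contra h2
            exact hcon (Or.inr h2)
        rw [hx, Pi.add_apply, h1.1, h1.2, add_zero]
      exact ((measure_mono_ae h).trans (measure_union_le _ _)).trans_lt
        (ENNReal.add_lt_top.2 ⟨hf, hg⟩)
    · simp only [lGauge, hr, if_false, mem_ofPred_eq] at hf hg ⊢
      rw [eLpNorm_congr_ae (AEEqFun.coeFn_add f g)]
      exact (MemLp.add ⟨f.aestronglyMeasurable, hf⟩ ⟨g.aestronglyMeasurable, hg⟩).2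
  smul_mem' := by
    intro c f hf
    by_cases hr : r = 0
    · simp only [lGauge, hr, if_true, mem_ofPred_eq] at hf ⊢
      have h : Function.support ((c • f : Ω →ₘ[m] 𝕜) : Ω → 𝕜) ≤ᵐ[m]
          (Function.support f : Set Ω) := by
        filter_upwards [AEEqFun.coeFn_smul c f] with x hx hxs hfx
        apply hxs
        rw [hx, Pi.smul_apply, hfx, smul_zero]
      exact (measure_mono_ae h).trans_lt hf
    · simp only [lGauge, hr, if_false, mem_ofPred_eq] at hf ⊢
      rw [eLpNorm_congr_ae (AEEqFun.coeFn_smul c f)]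
      exact (MemLp.const_smul ⟨f.aestronglyMeasurable, hf⟩ c).2

/-- A quasi-Banach function space: a linear space of measurable functions with a complete
quasi-norm that is an ideal for the pointwise order of absolute values. Only the values of `nrm`
on `carrier` are meaningful. -/
structure QuasiBanachFunctionSpace (𝕜 : Type*) [RCLike 𝕜] (m : Measure Ω) where
  carrier : Submodule 𝕜 (Ω →ₘ[m] 𝕜)
  nrm : (Ω →ₘ[m] 𝕜) → ℝ
  nrm_nonneg : ∀ f ∈ carrier, 0 ≤ nrm f
  nrm_eq_zero_iff : ∀ f ∈ carrier, (nrm f = 0 ↔ f = 0)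
  nrm_smul : ∀ (a : 𝕜), ∀ f ∈ carrier, nrm (a • f) = ‖a‖ * nrm f
  nrm_add_le : ∃ K : ℝ, ∀ f ∈ carrier, ∀ g ∈ carrier, nrm (f + g) ≤ K * (nrm f + nrm g)
  complete : ∀ u : ℕ → (Ω →ₘ[m] 𝕜), (∀ n, u n ∈ carrier) →
    (∀ ε : ℝ, 0 < ε → ∃ N : ℕ, ∀ i ≥ N, ∀ j ≥ N, nrm (u i - u j) < ε) →
    ∃ f ∈ carrier, Tendsto (fun n => nrm (u n - f)) atTop (𝓝 0)
  ideal : ∀ f ∈ carrier, ∀ g : Ω →ₘ[m] 𝕜, (∀ᵐ x ∂m, ‖g x‖ ≤ ‖f x‖) →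
    g ∈ carrier ∧ nrm g ≤ nrm f

/-- The right-continuous decreasing rearrangement
`μ(t, f) = inf {s ≥ 0 : m {|f| > s} ≤ t}`. -/
def rearrangement (f : Ω →ₘ[m] 𝕜) (t : ℝ) : ℝ≥0∞ :=
  sInf {s : ℝ≥0∞ | m {x | s < ‖f x‖ₑ} ≤ ENNReal.ofReal t}

/-- The function `|f|^r`. -/
def absPow (f : Ω →ₘ[m] 𝕜) (r : ℝ) : Ω →ₘ[m] ℝ :=
  AEEqFun.compMeasurable (fun z : 𝕜 => ‖z‖ ^ r) (measurable_norm.pow_const r) f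

/-- Head majorization `g ≺≺_hd f`, a relation on `L_1 + L_∞`. -/
def HeadMaj (g f : Ω →ₘ[m] ℝ) : Prop :=
  g ∈ lSpace ℝ m 1 ⊔ lSpace ℝ m ∞ ∧ f ∈ lSpace ℝ m 1 ⊔ lSpace ℝ m ∞ ∧
    ∀ t : ℝ, 0 < t →
      ∫⁻ s in Ioo 0 t, rearrangement g s ≤ ∫⁻ s in Ioo 0 t, rearrangement f s

/-- Tail majorization `g ≺≺_tl f`, a relation on `L_0 + L_1`. -/
def TailMaj (g f : Ω →ₘ[m] ℝ) : Prop :=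
  g ∈ lSpace ℝ m 0 ⊔ lSpace ℝ m 1 ∧ f ∈ lSpace ℝ m 0 ⊔ lSpace ℝ m 1 ∧
    ∀ t : ℝ, 0 < t →
      ∫⁻ s in Ioi t, rearrangement g s ≤ ∫⁻ s in Ioi t, rearrangement f s

/-- A linear operator on `L_p + L_q` restricts to a bounded operator from `L_r` to `L_r`. -/
def BoundedOnL {p q : ℝ≥0∞}
    (T : ↥(lSpace 𝕜 m p ⊔ lSpace 𝕜 m q) →ₗ[𝕜] ↥(lSpace 𝕜 m p ⊔ lSpace 𝕜 m q))
    (r : ℝ≥0∞) : Prop :=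
  ∃ C : ℝ≥0, ∀ f : ↥(lSpace 𝕜 m p ⊔ lSpace 𝕜 m q), (f : Ω →ₘ[m] 𝕜) ∈ lSpace 𝕜 m r →
    (T f : Ω →ₘ[m] 𝕜) ∈ lSpace 𝕜 m r ∧
      lGauge r (T f : Ω →ₘ[m] 𝕜) ≤ C * lGauge r (f : Ω →ₘ[m] 𝕜)

/-- `E ∈ Int(L_p, L_q)`: `L_p ∩ L_q ⊆ E ⊆ L_p + L_q`, and every linear operator on `L_p + L_q`
which is bounded on `L_p` and on `L_q` restricts to a bounded operator on `E`. -/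
def IsInterpolationSpace (E : QuasiBanachFunctionSpace 𝕜 m) (p q : ℝ≥0∞) : Prop :=
  lSpace 𝕜 m p ⊓ lSpace 𝕜 m q ≤ E.carrier ∧
  E.carrier ≤ lSpace 𝕜 m p ⊔ lSpace 𝕜 m q ∧
  ∀ T : ↥(lSpace 𝕜 m p ⊔ lSpace 𝕜 m q) →ₗ[𝕜] ↥(lSpace 𝕜 m p ⊔ lSpace 𝕜 m q),
    BoundedOnL T p → BoundedOnL T q →
    ∃ C : ℝ, ∀ f : ↥(lSpace 𝕜 m p ⊔ lSpace 𝕜 m q), (f : Ω →ₘ[m] 𝕜) ∈ E.carrier →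
      (T f : Ω →ₘ[m] 𝕜) ∈ E.carrier ∧
        E.nrm (T f : Ω →ₘ[m] 𝕜) ≤ C * E.nrm (f : Ω →ₘ[m] 𝕜)

end Definitions

/-- Lebesgue measure on `(0,∞)`. -/
def halfLine : Measure ℝ := volume.restrict (Ioi 0)

end

/-!
Let `T` be bounded on `L_p` and on `L_q`, and let `g = T f`. For each `u > 0`, cut `f` at a level
determined by its rearrangement on `(0, u)`: the part above the level lies in `L_p`, the part below
it in `L_q`, and their norms are governed by the integral of `μ(·, f)^p` over `(0, u)` and that of
`μ(·, f)^q` over `(u, ∞)`. Applying `T` to both parts shows, in the interior case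
`0 < p < q < ∞`, that for every `u` one of two alternatives holds up to constants:
`∫₀ᵘ μ(s, g)^p ds ≤ κ₁ ∫₀ᵘ μ(s, f)^p ds` or `∫ᵤ^∞ μ(s, g)^q ds ≤ κ₂ ∫ᵤ^∞ μ(s, f)^q ds`.
The rearrangement of `g` is the sum of its restriction to the set of those `u` where the first
alternative holds, which is head majorized by a multiple of `f`, and of its restriction to the
complement, which is tail majorized by a multiple of `f`; hypotheses (i) and (ii) put both parts
into `E`, and `g` has the same rearrangement as their sum.

When `q = ∞`, head majorization holds for every `u`. When `p = 0`, the image of the part above the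
level is small only in support, which gives tail majorization after a dilation,
`∫_{au}^∞ μ(s, g)^q ds ≤ κ ∫ᵤ^∞ μ(s, f)^q ds`. To absorb the dilation, split `(0, ∞)` into
`{x | ⌊log₂ x⌋ even}` and its complement. Doubling interchanges these sets, so each fills at most
two thirds of every interval `(0, x)`, and restricting the rearrangement of `g` to either of them
multiplies `a` by `2 / 3`; iterate until `a ≤ 1`.
-/

noncomputable section

instance sigmaFinite_halfLine : SigmaFinite halfLine := by
  unfold halfLine
  infer_instance

section Rearrangement

variable {Ω : Type*} [MeasurableSpace Ω] {m : Measure Ω} {F G : Ω → ℝ≥0∞}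

/-- The decreasing rearrangement `F*(t) = inf {s : m {F > s} ≤ t}` of a function with values in
`[0, ∞]`; `rearrangement f` is the case `F = |f|`. -/
def decrRearr (m : Measure Ω) (F : Ω → ℝ≥0∞) (t : ℝ) : ℝ≥0∞ :=
  sInf {s : ℝ≥0∞ | m {x | s < F x} ≤ ENNReal.ofReal t}

/-- The integral of the decreasing rearrangement over a set `I`. The intervals `(0, t)` and
`(t, ∞)` give the integrals compared in head and tail majorization. -/
def rearrInt (m : Measure Ω) (F : Ω → ℝ≥0∞) (I : Set ℝ) : ℝ≥0∞ :=
  ∫⁻ s in I, decrRearr m F s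

lemma decrRearr_le_iff {t : ℝ} {s : ℝ≥0∞} :
    decrRearr m F t ≤ s ↔ m {x | s < F x} ≤ ENNReal.ofReal t := by
  refine ⟨fun h => ?_, fun h => sInf_le h⟩
  rcases eq_or_ne s ∞ with rfl | hs
  · simp
  obtain ⟨u, hu, hus, hlim⟩ := exists_seq_strictAnti_tendsto' (lt_top_iff_ne_top.2 hs)
  have hU : {x | s < F x} = ⋃ n, {x | u n < F x} := by
    ext x
    simp only [mem_ofPred_eq, mem_iUnion]
    exact ⟨fun hx => (hlim.eventually_lt_const hx).exists, fun ⟨n, hn⟩ => (hus n).1.trans hn⟩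
  have hmono : Monotone fun n => {x | u n < F x} := fun i j hij x hx =>
    (hu.antitone hij).trans_lt hx
  rw [hU, hmono.measure_iUnion]
  refine iSup_le fun n => ?_
  obtain ⟨s', hs', hlt⟩ := sInf_lt_iff.1 (h.trans_lt (hus n).1)
  exact (measure_mono fun x hx => hlt.trans hx).trans hs'

lemma lt_decrRearr_iff {t : ℝ} {s : ℝ≥0∞} :
    s < decrRearr m F t ↔ ENNReal.ofReal t < m {x | s < F x} := by
  rw [← not_le, decrRearr_le_iff, not_le]

lemma measure_decrRearr_lt_le (t : ℝ) : m {x | decrRearr m F t < F x} ≤ ENNReal.ofReal t :=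
  decrRearr_le_iff.1 le_rfl

lemma decrRearr_antitone : Antitone (decrRearr m F) := fun _ _ h =>
  decrRearr_le_iff.2 ((measure_decrRearr_lt_le _).trans (ENNReal.ofReal_le_ofReal h))

lemma measurable_decrRearr : Measurable (decrRearr m F) := decrRearr_antitone.measurable

lemma decrRearr_mono (h : F ≤ᵐ[m] G) (t : ℝ) : decrRearr m F t ≤ decrRearr m G t := by
  refine decrRearr_le_iff.2 ((measure_mono_ae ?_).trans (measure_decrRearr_lt_le (F := G) t))
  filter_upwards [h] with x hx hlt
  exact hlt.trans_le hx

lemma decrRearr_congr (h : F =ᵐ[m] G) : decrRearr m F = decrRearr m G :=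
  funext fun t => (decrRearr_mono h.le t).antisymm (decrRearr_mono h.symm.le t)

lemma decrRearr_rpow {r : ℝ} (hr : 0 < r) (t : ℝ) :
    decrRearr m (fun x => F x ^ r) t = decrRearr m F t ^ r := by
  refine eq_of_forall_ge_iff fun s => ?_
  rw [← ENNReal.le_rpow_inv_iff hr, decrRearr_le_iff, decrRearr_le_iff]
  simp only [ENNReal.rpow_inv_lt_iff hr]

lemma decrRearr_const_mul {c : ℝ≥0∞} (hc : c ≠ ∞) (t : ℝ) :
    decrRearr m (fun x => c * F x) t = c * decrRearr m F t := by
  refine eq_of_forall_ge_iff fun s => ?_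
  rcases eq_or_ne c 0 with rfl | hc0
  · simp [decrRearr_le_iff]
  rw [mul_comm c, ← ENNReal.le_div_iff_mul_le (Or.inl hc0) (Or.inl hc), decrRearr_le_iff,
    decrRearr_le_iff]
  simp only [ENNReal.div_lt_iff (Or.inl hc0) (Or.inl hc), mul_comm c]

lemma decrRearr_tsub_const (b : ℝ≥0∞) (t : ℝ) :
    decrRearr m (fun x => F x - b) t = decrRearr m F t - b := by
  refine eq_of_forall_ge_iff fun s => ?_
  rw [tsub_le_iff_right, decrRearr_le_iff, decrRearr_le_iff]
  simp only [lt_tsub_iff_right]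

lemma decrRearr_iSup {F : ℕ → Ω → ℝ≥0∞} (hF : Monotone F) (t : ℝ) :
    decrRearr m (fun x => ⨆ n, F n x) t = ⨆ n, decrRearr m (F n) t := by
  refine eq_of_forall_lt_iff fun s => ?_
  have hmono : Monotone fun n => {x | s < F n x} := fun i j hij x hx => lt_of_lt_of_le hx (hF hij x)
  simp only [lt_iSup_iff, lt_decrRearr_iff, ofPred_exists, hmono.measure_iUnion]

lemma decrRearr_lt_top (hF : Measurable F) (hfin : ∀ x, F x ≠ ∞) {T : ℝ}
    (hT : decrRearr m F T < ∞) {t : ℝ} (ht : 0 < t) : decrRearr m F t < ∞ := by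
  let S : ℕ → Set Ω := fun n => {x | decrRearr m F T + n < F x}
  have hinter : ⋂ n, S n = ∅ := by
    refine eq_empty_of_forall_notMem fun x hx => ?_
    obtain ⟨n, hn⟩ := ENNReal.exists_nat_gt (hfin x)
    have hxn : decrRearr m F T + n < F x := mem_iInter.1 hx n
    exact hn.not_gt (le_add_self.trans_lt hxn)
  have hanti : Antitone S := fun i j hij x (hx : _ < F x) => lt_of_le_of_lt (by gcongr) hx
  have hfinite : m (S 0) ≠ ∞ := by
    refine ne_top_of_le_ne_top (ENNReal.ofReal_ne_top (r := T)) ?_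
    simpa only [S, Nat.cast_zero, add_zero] using measure_decrRearr_lt_le (m := m) (F := F) T
  have hlim : Tendsto (fun n => m (S n)) atTop (𝓝 0) := by
    rw [← measure_empty (μ := m), ← hinter]
    exact tendsto_measure_iInter_atTop
      (fun n => (measurableSet_lt measurable_const hF).nullMeasurableSet) hanti ⟨0, hfinite⟩
  obtain ⟨n, hn⟩ := (hlim.eventually_lt_const (ENNReal.ofReal_pos.2 ht)).exists
  exact (decrRearr_le_iff.2 hn.le).trans_lt (ENNReal.add_lt_top.2 ⟨hT, ENNReal.natCast_lt_top n⟩)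

lemma decrRearr_indicator_const (A : Set Ω) (c : ℝ≥0∞) :
    decrRearr m (A.indicator fun _ => c) =
      {t | ENNReal.ofReal t < m A}.indicator fun _ => c := by
  funext t
  refine eq_of_forall_lt_iff fun s => ?_
  have hlevel : {x | s < A.indicator (fun _ => c) x} = {x ∈ A | s < c} := by
    ext x
    by_cases hx : x ∈ A <;> simp [hx]
  rw [lt_decrRearr_iff, hlevel]
  by_cases hs : s < c <;> by_cases ht : ENNReal.ofReal t < m A <;> simp [hs, ht]

lemma volume_restrict_Ioo_ofReal_lt (t : ℝ) (d : ℝ≥0∞) :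
    volume.restrict (Ioo 0 t) {s : ℝ | ENNReal.ofReal s < d} = min (ENNReal.ofReal t) d := by
  rw [Measure.restrict_apply' measurableSet_Ioo]
  rcases eq_or_ne d ∞ with rfl | hd
  · simp
  have hset : {s : ℝ | ENNReal.ofReal s < d} ∩ Ioo 0 t = Ioo 0 (min t d.toReal) := by
    ext s
    simp only [mem_inter_iff, mem_ofPred_eq, mem_Ioo, lt_min_iff]
    have (hs : 0 < s) := ENNReal.ofReal_lt_iff_lt_toReal hs.le hd
    tauto
  rw [hset, Real.volume_Ioo, sub_zero, ENNReal.ofReal_min, ENNReal.ofReal_toReal hd]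

lemma volume_restrict_Ioi_ofReal_lt {t : ℝ} (ht : 0 ≤ t) (d : ℝ≥0∞) :
    volume.restrict (Ioi t) {s : ℝ | ENNReal.ofReal s < d} = d - ENNReal.ofReal t := by
  rw [Measure.restrict_apply' measurableSet_Ioi]
  rcases eq_or_ne d ∞ with rfl | hd
  · simp
  have hset : {s : ℝ | ENNReal.ofReal s < d} ∩ Ioi t = Ioo t d.toReal := by
    ext s
    simp only [mem_inter_iff, mem_ofPred_eq, mem_Ioi, mem_Ioo]
    have (hs : t < s) := ENNReal.ofReal_lt_iff_lt_toReal (ht.trans hs.le) hd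
    tauto
  rw [hset, Real.volume_Ioo, ENNReal.ofReal_sub _ ht, ENNReal.ofReal_toReal hd]

lemma halfLine_ofReal_lt (d : ℝ≥0∞) : halfLine {s : ℝ | ENNReal.ofReal s < d} = d := by
  rw [halfLine, volume_restrict_Ioi_ofReal_lt le_rfl, ENNReal.ofReal_zero, tsub_zero]

lemma halfLine_lt_decrRearr (s : ℝ≥0∞) :
    halfLine {t | s < decrRearr m F t} = m {x | s < F x} := by
  simp only [lt_decrRearr_iff, halfLine_ofReal_lt]

lemma decrRearr_decrRearr : decrRearr halfLine (decrRearr m F) = decrRearr m F := by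
  funext t
  refine eq_of_forall_ge_iff fun s => ?_
  rw [decrRearr_le_iff, decrRearr_le_iff, halfLine_lt_decrRearr]

lemma lintegral_eq_lintegral_meas_ofReal_lt [SFinite m] (hF : Measurable F) :
    ∫⁻ x, F x ∂m = ∫⁻ s, m {x | ENNReal.ofReal s < F x} ∂halfLine := by
  let S : Set (Ω × ℝ) := {z | ENNReal.ofReal z.2 < F z.1}
  have hS : MeasurableSet S :=
    measurableSet_lt (ENNReal.measurable_ofReal.comp measurable_snd) (hF.comp measurable_fst)
  calc ∫⁻ x, F x ∂m = ∫⁻ x, halfLine (Prod.mk x ⁻¹' S) ∂m :=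
        lintegral_congr fun x => (halfLine_ofReal_lt (F x)).symm
    _ = (m.prod halfLine) S := (Measure.prod_apply hS).symm
    _ = ∫⁻ s, m {x | ENNReal.ofReal s < F x} ∂halfLine := Measure.prod_apply_symm hS

end Rearrangement

section RearrangementIntegrals

variable {Ω : Type*} [MeasurableSpace Ω] {m : Measure Ω} {F G : Ω → ℝ≥0∞}

lemma rearrInt_mono_set {I J : Set ℝ} (h : I ⊆ J) : rearrInt m F I ≤ rearrInt m F J :=
  lintegral_mono_set h

lemma rearrInt_congr (h : F =ᵐ[m] G) : rearrInt m F = rearrInt m G := by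
  funext I
  rw [rearrInt, rearrInt, decrRearr_congr h]

lemma rearrInt_const_mul {c : ℝ≥0∞} (hc : c ≠ ∞) (I : Set ℝ) :
    rearrInt m (fun x => c * F x) I = c * rearrInt m F I := by
  simp only [rearrInt, decrRearr_const_mul hc, lintegral_const_mul _ measurable_decrRearr]

lemma rearrInt_iSup {F : ℕ → Ω → ℝ≥0∞} (hF : Monotone F) (I : Set ℝ) :
    rearrInt m (fun x => ⨆ n, F n x) I = ⨆ n, rearrInt m (F n) I := by
  simp only [rearrInt, decrRearr_iSup hF]
  exact lintegral_iSup (fun n => measurable_decrRearr) fun i j hij =>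
    decrRearr_mono (Eventually.of_forall (hF hij))

lemma rearrInt_decrRearr (I : Set ℝ) :
    rearrInt halfLine (decrRearr m F) I = rearrInt m F I := by
  rw [rearrInt, decrRearr_decrRearr, rearrInt]

lemma rearrInt_Ioo_eq (t : ℝ) : rearrInt m F (Ioo 0 t) =
    ∫⁻ s, min (ENNReal.ofReal t) (m {x | ENNReal.ofReal s < F x}) ∂halfLine := by
  rw [rearrInt, lintegral_eq_lintegral_meas_ofReal_lt measurable_decrRearr]
  simp only [lt_decrRearr_iff, volume_restrict_Ioo_ofReal_lt]

lemma rearrInt_Ioi_eq {t : ℝ} (ht : 0 ≤ t) : rearrInt m F (Ioi t) =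
    ∫⁻ s, (m {x | ENNReal.ofReal s < F x} - ENNReal.ofReal t) ∂halfLine := by
  rw [rearrInt, lintegral_eq_lintegral_meas_ofReal_lt measurable_decrRearr]
  simp only [lt_decrRearr_iff, volume_restrict_Ioi_ofReal_lt ht]

lemma rearrInt_le_lintegral [SFinite m] (hF : Measurable F) {I : Set ℝ} (hI : I ⊆ Ioi 0) :
    rearrInt m F I ≤ ∫⁻ x, F x ∂m := by
  refine (rearrInt_mono_set hI).trans_eq ?_
  rw [rearrInt_Ioi_eq le_rfl, lintegral_eq_lintegral_meas_ofReal_lt hF]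
  simp only [ENNReal.ofReal_zero, tsub_zero]

lemma setLIntegral_le_rearrInt_Ioo [SFinite m] (hF : Measurable F) {A : Set Ω} {t : ℝ}
    (hAt : m A ≤ ENNReal.ofReal t) : ∫⁻ x in A, F x ∂m ≤ rearrInt m F (Ioo 0 t) := by
  rw [rearrInt_Ioo_eq, lintegral_eq_lintegral_meas_ofReal_lt hF]
  refine lintegral_mono fun s => le_min ?_ (Measure.restrict_apply_le _ _)
  exact (measure_mono (subset_univ _)).trans ((Measure.restrict_apply_univ A).trans_le hAt)

lemma rearrInt_Ioi_le [SFinite m] (hF : Measurable F) {A : Set Ω} (hA : MeasurableSet A) {t : ℝ}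
    (ht : 0 ≤ t) (hAt : m A ≤ ENNReal.ofReal t) :
    rearrInt m F (Ioi t) ≤ ∫⁻ x in Aᶜ, F x ∂m := by
  rw [rearrInt_Ioi_eq ht, lintegral_eq_lintegral_meas_ofReal_lt hF]
  refine lintegral_mono fun s => ?_
  rw [tsub_le_iff_left, Measure.restrict_apply' hA.compl,
    ← measure_inter_add_sdiff {x | ENNReal.ofReal s < F x} hA, sdiff_eq]
  gcongr
  exact (measure_mono inter_subset_right).trans hAt

lemma rearrInt_Ioo_le_add [SFinite m] (hF : Measurable F) (b : ℝ≥0∞) (t : ℝ) :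
    rearrInt m F (Ioo 0 t) ≤ ∫⁻ x, (F x - b) ∂m + ENNReal.ofReal t * b :=
  calc rearrInt m F (Ioo 0 t) ≤ ∫⁻ s in Ioo 0 t, (decrRearr m (fun x => F x - b) s + b) :=
        lintegral_mono fun s => le_tsub_add.trans_eq (by rw [decrRearr_tsub_const])
    _ = rearrInt m (fun x => F x - b) (Ioo 0 t) + ENNReal.ofReal t * b := by
        rw [lintegral_add_right _ measurable_const, setLIntegral_const, Real.volume_Ioo, sub_zero,
          mul_comm b, rearrInt]
    _ ≤ _ := by
        gcongr
        exact rearrInt_le_lintegral (hF.sub_const b) Ioo_subset_Ioi_self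

lemma mul_decrRearr_le_rearrInt_Ioo (t : ℝ) :
    ENNReal.ofReal t * decrRearr m F t ≤ rearrInt m F (Ioo 0 t) :=
  calc ENNReal.ofReal t * decrRearr m F t = ∫⁻ _ in Ioo 0 t, decrRearr m F t := by
        rw [setLIntegral_const, Real.volume_Ioo, sub_zero, mul_comm]
    _ ≤ _ := setLIntegral_mono measurable_decrRearr fun s hs => decrRearr_antitone hs.2.le

lemma mul_decrRearr_le_rearrInt_Ioi (t : ℝ) :
    ENNReal.ofReal t * decrRearr m F (2 * t) ≤ rearrInt m F (Ioi t) :=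
  calc ENNReal.ofReal t * decrRearr m F (2 * t)
      = ∫⁻ _ in Ioc t (2 * t), decrRearr m F (2 * t) := by
        rw [setLIntegral_const, Real.volume_Ioc, mul_comm, two_mul, add_sub_cancel_right]
    _ ≤ ∫⁻ s in Ioc t (2 * t), decrRearr m F s :=
        setLIntegral_mono measurable_decrRearr fun s hs => decrRearr_antitone hs.2
    _ ≤ _ := lintegral_mono_set Ioc_subset_Ioi_self

lemma mul_rearrInt_Ioo_le_mul_rearrInt_Ioo {s t : ℝ} (hst : s ≤ t) :
    ENNReal.ofReal s * rearrInt m F (Ioo 0 t) ≤ ENNReal.ofReal t * rearrInt m F (Ioo 0 s) := by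
  rw [rearrInt_Ioo_eq, rearrInt_Ioo_eq, ← lintegral_const_mul' _ _ ENNReal.ofReal_ne_top,
    ← lintegral_const_mul' _ _ ENNReal.ofReal_ne_top]
  refine lintegral_mono fun x => ?_
  have h := ENNReal.ofReal_le_ofReal hst
  rw [mul_min, mul_min, mul_comm (ENNReal.ofReal s)]
  refine le_min (min_le_left _ _) ((min_le_right _ _).trans ?_)
  gcongr

lemma rearrInt_Ioo_lt_top {T : ℝ} (hT : 0 < T) (h : rearrInt m F (Ioo 0 T) < ∞) (t : ℝ) :
    rearrInt m F (Ioo 0 t) < ∞ := by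
  rcases le_total t T with htT | hTt
  · exact (rearrInt_mono_set (Ioo_subset_Ioo_right htT)).trans_lt h
  · exact ENNReal.lt_top_of_mul_ne_top_right ((mul_rearrInt_Ioo_le_mul_rearrInt_Ioo hTt).trans_lt
      (ENNReal.mul_lt_top ENNReal.ofReal_lt_top h)).ne (ENNReal.ofReal_pos.2 hT).ne'

lemma setLIntegral_le_mul_add_rearrInt_Ioi [SFinite m] (hF : Measurable F) (b : ℝ≥0∞) {t : ℝ}
    (ht : 0 ≤ t) :
    ∫⁻ x in {x | F x ≤ b}, F x ∂m ≤ ENNReal.ofReal t * b + rearrInt m F (Ioi t) := by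
  have hlevel : MeasurableSet {s : ℝ | ENNReal.ofReal s < b} :=
    measurableSet_lt ENNReal.measurable_ofReal measurable_const
  have hmul : ENNReal.ofReal t * b =
      ∫⁻ s, {s : ℝ | ENNReal.ofReal s < b}.indicator (fun _ => ENNReal.ofReal t) s ∂halfLine := by
    rw [lintegral_indicator_const hlevel, halfLine_ofReal_lt]
  rw [rearrInt_Ioi_eq ht, lintegral_eq_lintegral_meas_ofReal_lt hF, hmul,
    ← lintegral_add_left (measurable_const.indicator hlevel)]
  refine lintegral_mono fun s => ?_
  rw [Measure.restrict_apply' (measurableSet_le hF measurable_const)]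
  by_cases hs : ENNReal.ofReal s < b
  · rw [indicator_of_mem (by exact hs)]
    exact (measure_mono inter_subset_left).trans le_add_tsub
  · have hempty : {x | ENNReal.ofReal s < F x} ∩ {x | F x ≤ b} = ∅ :=
      eq_empty_of_forall_notMem fun x hx => hs (hx.1.trans_le hx.2)
    rw [hempty, measure_empty]
    exact zero_le

lemma rearrInt_Ioo_indicator_const (A : Set Ω) (c : ℝ≥0∞) (t : ℝ) :
    rearrInt m (A.indicator fun _ => c) (Ioo 0 t) = c * min (ENNReal.ofReal t) (m A) := by
  rw [rearrInt, decrRearr_indicator_const, lintegral_indicator_const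
    (measurableSet_lt ENNReal.measurable_ofReal measurable_const), volume_restrict_Ioo_ofReal_lt]

lemma rearrInt_Ioi_indicator_const (A : Set Ω) (c : ℝ≥0∞) {t : ℝ} (ht : 0 ≤ t) :
    rearrInt m (A.indicator fun _ => c) (Ioi t) = c * (m A - ENNReal.ofReal t) := by
  rw [rearrInt, decrRearr_indicator_const, lintegral_indicator_const
    (measurableSet_lt ENNReal.measurable_ofReal measurable_const),
    volume_restrict_Ioi_ofReal_lt ht]

end RearrangementIntegrals

section Spaces

variable {Ω : Type*} [MeasurableSpace Ω] {m : Measure Ω} {𝕜 : Type*} [RCLike 𝕜]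

/-- The function `|f|^r` with values in `[0, ∞]`. -/
def ePow (f : Ω →ₘ[m] 𝕜) (r : ℝ) (x : Ω) : ℝ≥0∞ := ‖f x‖ₑ ^ r

lemma measurable_enorm_coe (f : Ω →ₘ[m] 𝕜) : Measurable fun x => ‖f x‖ₑ :=
  f.stronglyMeasurable.measurable.enorm

lemma measurable_ePow (f : Ω →ₘ[m] 𝕜) (r : ℝ) : Measurable (ePow f r) :=
  (measurable_enorm_coe f).pow_const r

lemma measurableSet_lt_enorm (f : Ω →ₘ[m] 𝕜) (b : ℝ≥0∞) : MeasurableSet {x | b < ‖f x‖ₑ} :=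
  measurableSet_lt measurable_const (measurable_enorm_coe f)

lemma ePow_ne_top (f : Ω →ₘ[m] 𝕜) {r : ℝ} (hr : 0 ≤ r) (x : Ω) : ePow f r x ≠ ∞ :=
  ENNReal.rpow_ne_top_of_nonneg hr enorm_ne_top

lemma decrRearr_ePow (f : Ω →ₘ[m] 𝕜) {r : ℝ} (hr : 0 < r) (t : ℝ) :
    decrRearr m (ePow f r) t = decrRearr m (fun x => ‖f x‖ₑ) t ^ r :=
  decrRearr_rpow hr t

lemma ePow_absPow (f : Ω →ₘ[m] 𝕜) {r : ℝ} (hr : 0 ≤ r) :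
    ePow (absPow f r) 1 =ᵐ[m] ePow f r := by
  filter_upwards [AEEqFun.coeFn_compMeasurable (fun z : 𝕜 => ‖z‖ ^ r)
    (measurable_norm.pow_const r) f] with x hx
  rw [ePow, ePow, absPow, hx, ENNReal.rpow_one, Function.comp_apply,
    Real.enorm_rpow_of_nonneg (norm_nonneg _) hr, enorm_norm]

lemma rearrangement_absPow (f : Ω →ₘ[m] 𝕜) {r : ℝ} (hr : 0 ≤ r) :
    rearrangement (absPow f r) = decrRearr m (ePow f r) := by
  rw [← decrRearr_congr (ePow_absPow f hr)]
  funext t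
  simp only [rearrangement, decrRearr, ePow, ENNReal.rpow_one]

lemma ePow_smul (a : 𝕜) (f : Ω →ₘ[m] 𝕜) {r : ℝ} (hr : 0 ≤ r) :
    ePow (a • f) r =ᵐ[m] fun x => ‖a‖ₑ ^ r * ePow f r x := by
  filter_upwards [AEEqFun.coeFn_smul a f] with x hx
  rw [ePow, hx, Pi.smul_apply, enorm_smul, ENNReal.mul_rpow_of_nonneg _ _ hr, ePow]

lemma ePow_add_le (f g : Ω →ₘ[m] 𝕜) {r : ℝ} (hr : 0 < r) :
    ∀ᵐ x ∂m, ePow (f + g) r x ≤ 2 ^ r * (ePow f r x + ePow g r x) := by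
  filter_upwards [AEEqFun.coeFn_add f g] with x hx
  simp only [ePow, hx, Pi.add_apply]
  have h1 : ‖f x + g x‖ₑ ≤ 2 * max ‖f x‖ₑ ‖g x‖ₑ := by
    rw [two_mul]
    exact (enorm_add_le _ _).trans (add_le_add (le_max_left _ _) (le_max_right _ _))
  calc ‖f x + g x‖ₑ ^ r ≤ (2 * max ‖f x‖ₑ ‖g x‖ₑ) ^ r := ENNReal.rpow_le_rpow h1 hr.le
    _ = 2 ^ r * (max ‖f x‖ₑ ‖g x‖ₑ) ^ r := ENNReal.mul_rpow_of_nonneg _ _ hr.le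
    _ ≤ 2 ^ r * (‖f x‖ₑ ^ r + ‖g x‖ₑ ^ r) := by
        gcongr
        rcases max_cases ‖f x‖ₑ ‖g x‖ₑ with h | h <;> rw [h.1]
        · exact le_self_add
        · exact le_add_self

lemma lGauge_zero (f : Ω →ₘ[m] 𝕜) : lGauge 0 f = m (Function.support f) := if_pos rfl

lemma lGauge_top (f : Ω →ₘ[m] 𝕜) : lGauge ∞ f = essSup (fun x => ‖f x‖ₑ) m := by
  rw [lGauge, if_neg ENNReal.top_ne_zero, eLpNorm_exponent_top, eLpNormEssSup]

lemma lGauge_rpow {r : ℝ≥0∞} (h0 : r ≠ 0) (ht : r ≠ ∞) (f : Ω →ₘ[m] 𝕜) :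
    lGauge r f ^ r.toReal = ∫⁻ x, ePow f r.toReal x ∂m := by
  rw [lGauge, if_neg h0, eLpNorm_eq_lintegral_rpow_enorm_toReal h0 ht, ← ENNReal.rpow_mul,
    one_div, inv_mul_cancel₀ (ENNReal.toReal_pos h0 ht).ne', ENNReal.rpow_one]
  rfl

lemma mem_lSpace_iff {r : ℝ≥0∞} {f : Ω →ₘ[m] 𝕜} : f ∈ lSpace 𝕜 m r ↔ lGauge r f < ∞ := Iff.rfl

lemma mem_lSpace_iff_lintegral {r : ℝ≥0∞} (h0 : r ≠ 0) (ht : r ≠ ∞) {f : Ω →ₘ[m] 𝕜} :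
    f ∈ lSpace 𝕜 m r ↔ ∫⁻ x, ePow f r.toReal x ∂m < ∞ := by
  rw [mem_lSpace_iff, ← lGauge_rpow h0 ht,
    ENNReal.rpow_lt_top_iff_of_pos (ENNReal.toReal_pos h0 ht)]

lemma lintegral_ePow_le_of_lGauge_le {r : ℝ≥0∞} (h0 : r ≠ 0) (ht : r ≠ ∞) {f g : Ω →ₘ[m] 𝕜}
    {C : ℝ≥0∞} (h : lGauge r g ≤ C * lGauge r f) :
    ∫⁻ x, ePow g r.toReal x ∂m ≤ C ^ r.toReal * ∫⁻ x, ePow f r.toReal x ∂m := by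
  rw [← lGauge_rpow h0 ht, ← lGauge_rpow h0 ht,
    ← ENNReal.mul_rpow_of_nonneg _ _ ENNReal.toReal_nonneg]
  exact ENNReal.rpow_le_rpow h ENNReal.toReal_nonneg

lemma ae_enorm_le_lGauge_top (f : Ω →ₘ[m] 𝕜) : ∀ᵐ x ∂m, ‖f x‖ₑ ≤ lGauge ∞ f := by
  rw [lGauge_top]
  exact ENNReal.ae_le_essSup _

lemma lGauge_top_le {f : Ω →ₘ[m] 𝕜} {C : ℝ≥0∞} (h : ∀ᵐ x ∂m, ‖f x‖ₑ ≤ C) :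
    lGauge ∞ f ≤ C := by
  rw [lGauge_top]
  exact essSup_le_of_ae_le C h

end Spaces

section Cut

variable {Ω : Type*} [MeasurableSpace Ω] {m : Measure Ω} {𝕜 : Type*} [RCLike 𝕜]

/-- The restriction `f · 1_S`. -/
def cut (f : Ω →ₘ[m] 𝕜) {S : Set Ω} (hS : MeasurableSet S) : Ω →ₘ[m] 𝕜 :=
  AEEqFun.mk (S.indicator f) (f.aestronglyMeasurable.indicator hS)

lemma coeFn_cut (f : Ω →ₘ[m] 𝕜) {S : Set Ω} (hS : MeasurableSet S) :
    cut f hS =ᵐ[m] S.indicator f := AEEqFun.coeFn_mk _ _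

lemma cut_add_cut_compl (f : Ω →ₘ[m] 𝕜) {S : Set Ω} (hS : MeasurableSet S) :
    cut f hS + cut f hS.compl = f := by
  refine AEEqFun.ext ?_
  filter_upwards [AEEqFun.coeFn_add (cut f hS) (cut f hS.compl), coeFn_cut f hS,
    coeFn_cut f hS.compl] with x h1 h2 h3
  rw [h1, Pi.add_apply, h2, h3, indicator_self_add_compl_apply]

lemma norm_cut_le (f : Ω →ₘ[m] 𝕜) {S : Set Ω} (hS : MeasurableSet S) :
    ∀ᵐ x ∂m, ‖cut f hS x‖ ≤ ‖f x‖ := by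
  filter_upwards [coeFn_cut f hS] with x hx
  rw [hx]
  exact norm_indicator_le_norm_self _ _

lemma ePow_cut (f : Ω →ₘ[m] 𝕜) {S : Set Ω} (hS : MeasurableSet S) {r : ℝ} (hr : 0 < r) :
    ePow (cut f hS) r =ᵐ[m] S.indicator (ePow f r) := by
  filter_upwards [coeFn_cut f hS] with x hx
  rw [ePow, hx]
  by_cases h : x ∈ S
  · simp [h, ePow]
  · simp [h, hr]

lemma lintegral_ePow_cut (f : Ω →ₘ[m] 𝕜) {S : Set Ω} (hS : MeasurableSet S) {r : ℝ}
    (hr : 0 < r) : ∫⁻ x, ePow (cut f hS) r x ∂m = ∫⁻ x in S, ePow f r x ∂m := by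
  rw [lintegral_congr_ae (ePow_cut f hS hr), lintegral_indicator hS]

lemma measure_support_cut_le (f : Ω →ₘ[m] 𝕜) {S : Set Ω} (hS : MeasurableSet S) :
    m (Function.support (cut f hS)) ≤ m S := by
  refine measure_mono_ae ?_
  filter_upwards [coeFn_cut f hS] with x hx hxs
  by_contra h
  exact hxs (by rw [hx, indicator_of_notMem h])

/-- The part `f · 1_{|f| > b}` of `f` above the level `b`. -/
def cutAbove (f : Ω →ₘ[m] 𝕜) (b : ℝ≥0∞) : Ω →ₘ[m] 𝕜 := cut f (measurableSet_lt_enorm f b)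

/-- The part `f · 1_{|f| ≤ b}` of `f` below the level `b`. -/
def cutBelow (f : Ω →ₘ[m] 𝕜) (b : ℝ≥0∞) : Ω →ₘ[m] 𝕜 := cut f (measurableSet_lt_enorm f b).compl

lemma cutAbove_add_cutBelow (f : Ω →ₘ[m] 𝕜) (b : ℝ≥0∞) : cutAbove f b + cutBelow f b = f :=
  cut_add_cut_compl f _

lemma measure_support_cutAbove_le (f : Ω →ₘ[m] 𝕜) (b : ℝ≥0∞) :
    m (Function.support (cutAbove f b)) ≤ m {x | b < ‖f x‖ₑ} :=
  measure_support_cut_le f _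

lemma lintegral_ePow_cutAbove_le [SFinite m] (f : Ω →ₘ[m] 𝕜) {r : ℝ} (hr : 0 < r) (t : ℝ) :
    ∫⁻ x, ePow (cutAbove f (decrRearr m (fun x => ‖f x‖ₑ) t)) r x ∂m ≤
      rearrInt m (ePow f r) (Ioo 0 t) := by
  rw [cutAbove, lintegral_ePow_cut _ _ hr]
  exact setLIntegral_le_rearrInt_Ioo (measurable_ePow f r) (measure_decrRearr_lt_le t)

lemma enorm_cutBelow_le (f : Ω →ₘ[m] 𝕜) (b : ℝ≥0∞) : ∀ᵐ x ∂m, ‖cutBelow f b x‖ₑ ≤ b := by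
  filter_upwards [coeFn_cut f (measurableSet_lt_enorm f b).compl] with x hx
  rw [cutBelow, hx]
  by_cases hxS : x ∈ {x | b < ‖f x‖ₑ}ᶜ
  · rw [indicator_of_mem hxS]
    exact not_lt.1 hxS
  · rw [indicator_of_notMem hxS, enorm_zero]
    exact zero_le

lemma lintegral_ePow_cutBelow_le [SFinite m] (f : Ω →ₘ[m] 𝕜) {r : ℝ} (hr : 0 < r)
    (b : ℝ≥0∞) {t : ℝ} (ht : 0 ≤ t) :
    ∫⁻ x, ePow (cutBelow f b) r x ∂m ≤
      ENNReal.ofReal t * b ^ r + rearrInt m (ePow f r) (Ioi t) := by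
  have hset : {x | b < ‖f x‖ₑ}ᶜ = {x | ePow f r x ≤ b ^ r} := by
    ext x
    simp only [mem_compl_iff, mem_ofPred_eq, not_lt, ePow, ENNReal.rpow_le_rpow_iff hr]
  rw [cutBelow, lintegral_ePow_cut _ _ hr, hset]
  exact setLIntegral_le_mul_add_rearrInt_Ioi (measurable_ePow f r) _ ht

end Cut

section Estimates

variable {Ω : Type*} [MeasurableSpace Ω] {m : Measure Ω} {𝕜 : Type*} [RCLike 𝕜]

lemma measure_lt_le_of_lintegral_le {F : Ω → ℝ≥0∞} (hF : Measurable F) {u b : ℝ≥0∞}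
    (h : ∫⁻ x, F x ∂m ≤ u * b) : m {x | b < F x} ≤ u := by
  rcases eq_or_ne b 0 with rfl | hb
  · rw [mul_zero, nonpos_iff_eq_zero, lintegral_eq_zero_iff hF] at h
    refine (le_of_eq ?_).trans zero_le
    simpa only [pos_iff_ne_zero, Pi.zero_apply] using ae_iff.1 h
  rcases eq_or_ne b ∞ with rfl | hb'
  · simp
  · have hmarkov := (mul_meas_ge_le_lintegral hF b).trans (h.trans_eq (mul_comm _ _))
    exact (measure_mono fun x (hx : b < F x) => hx.le).trans
      ((ENNReal.mul_le_mul_iff_right hb hb').1 hmarkov)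

lemma measure_lt_enorm_le_of_lintegral_le (f : Ω →ₘ[m] 𝕜) {r : ℝ} (hr : 0 < r) {u b : ℝ≥0∞}
    (h : ∫⁻ x, ePow f r x ∂m ≤ u * b ^ r) : m {x | b < ‖f x‖ₑ} ≤ u := by
  have hset : {x | b < ‖f x‖ₑ} = {x | b ^ r < ePow f r x} := by
    simp only [ePow, ENNReal.rpow_lt_rpow_iff hr]
  rw [hset]
  exact measure_lt_le_of_lintegral_le (measurable_ePow f r) h

lemma setLIntegral_ePow_le_mul_lintegral (f : Ω →ₘ[m] 𝕜) {p q : ℝ} (hp : 0 < p) (hpq : p ≤ q)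
    (b : ℝ≥0∞) : ∫⁻ x in {x | b < ‖f x‖ₑ}ᶜ, ePow f q x ∂m ≤
      b ^ (q - p) * ∫⁻ x, ePow f p x ∂m := by
  rw [← lintegral_const_mul _ (measurable_ePow f p)]
  refine le_trans ?_ (setLIntegral_le_lintegral {x | b < ‖f x‖ₑ}ᶜ _)
  refine setLIntegral_mono ((measurable_ePow f p).const_mul _) fun x hx => ?_
  calc ‖f x‖ₑ ^ q = ‖f x‖ₑ ^ (q - p) * ‖f x‖ₑ ^ p := by
        rw [← ENNReal.rpow_add_of_nonneg _ _ (sub_nonneg.2 hpq) hp.le, sub_add_cancel]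
    _ ≤ b ^ (q - p) * ‖f x‖ₑ ^ p := by
        gcongr
        exact not_lt.1 hx

lemma lintegral_ePow_sub_le_mul_lintegral (f : Ω →ₘ[m] 𝕜) {p q : ℝ} (hp : 0 < p) (hpq : p ≤ q)
    {b : ℝ≥0∞} (hb : b ≠ 0) : ∫⁻ x, (ePow f p x - b ^ p) ∂m ≤
      b ^ (p - q) * ∫⁻ x, ePow f q x ∂m := by
  rw [← lintegral_const_mul _ (measurable_ePow f q)]
  refine lintegral_mono fun x => ?_
  rcases le_total ‖f x‖ₑ b with hle | hge
  · exact (tsub_eq_zero_of_le (ENNReal.rpow_le_rpow hle hp.le)).trans_le zero_le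
  have hfx : ‖f x‖ₑ ≠ 0 := fun h0 => hb (le_antisymm (hge.trans_eq h0) zero_le)
  calc ePow f p x - b ^ p ≤ ‖f x‖ₑ ^ p := tsub_le_self
    _ = ‖f x‖ₑ ^ (p - q) * ‖f x‖ₑ ^ q := by
        rw [← ENNReal.rpow_add _ _ hfx enorm_ne_top, sub_add_cancel]
    _ ≤ b ^ (p - q) * ‖f x‖ₑ ^ q := by
        gcongr ?_ * _
        rw [← neg_sub q p, ENNReal.rpow_neg, ENNReal.rpow_neg, ENNReal.inv_le_inv]
        exact ENNReal.rpow_le_rpow hge (sub_nonneg.2 hpq)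

lemma rearrInt_Ioo_ePow_add_le [SFinite m] (f g : Ω →ₘ[m] 𝕜) {r : ℝ} (hr : 0 < r) (b : ℝ≥0∞)
    (u : ℝ) : rearrInt m (ePow (f + g) r) (Ioo 0 u) ≤ 2 ^ r *
      (∫⁻ x, ePow f r x ∂m + ∫⁻ x, (ePow g r x - b ^ r) ∂m + ENNReal.ofReal u * b ^ r) := by
  refine (rearrInt_Ioo_le_add (measurable_ePow _ _) (2 ^ r * b ^ r) u).trans ?_
  rw [mul_add (2 ^ r), mul_left_comm, ← lintegral_add_left (measurable_ePow _ _),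
    ← lintegral_const_mul' _ _ (ENNReal.rpow_ne_top_of_nonneg hr.le ENNReal.ofNat_ne_top)]
  gcongr ?_ + _
  refine lintegral_mono_ae ?_
  filter_upwards [ePow_add_le f g hr] with x hx
  rw [tsub_le_iff_right, ← mul_add, add_assoc]
  refine hx.trans ?_
  gcongr
  exact le_tsub_add

lemma rearrInt_Ioi_ePow_add_le [SFinite m] (f g : Ω →ₘ[m] 𝕜) {r : ℝ} (hr : 0 < r) {b : ℝ≥0∞}
    {u : ℝ} (hu : 0 ≤ u) (hf : m {x | b < ‖f x‖ₑ} ≤ ENNReal.ofReal u) :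
    rearrInt m (ePow (f + g) r) (Ioi u) ≤
      2 ^ r * (∫⁻ x in {x | b < ‖f x‖ₑ}ᶜ, ePow f r x ∂m + ∫⁻ x, ePow g r x ∂m) := by
  calc rearrInt m (ePow (f + g) r) (Ioi u)
      ≤ ∫⁻ x in {x | b < ‖f x‖ₑ}ᶜ, ePow (f + g) r x ∂m :=
        rearrInt_Ioi_le (measurable_ePow _ _) (measurableSet_lt_enorm f b) hu hf
    _ ≤ ∫⁻ x in {x | b < ‖f x‖ₑ}ᶜ, 2 ^ r * (ePow f r x + ePow g r x) ∂m :=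
        lintegral_mono_ae (ae_restrict_of_ae (ePow_add_le f g hr))
    _ = 2 ^ r * (∫⁻ x in {x | b < ‖f x‖ₑ}ᶜ, ePow f r x ∂m +
          ∫⁻ x in {x | b < ‖f x‖ₑ}ᶜ, ePow g r x ∂m) := by
        rw [lintegral_const_mul' _ _ (ENNReal.rpow_ne_top_of_nonneg hr.le ENNReal.ofNat_ne_top),
          lintegral_add_left (measurable_ePow f r)]
    _ ≤ _ := by
        gcongr
        exact Measure.restrict_le_self

lemma decrRearr_enorm_lt_top_of_rearrInt_Ioo {f : Ω →ₘ[m] 𝕜} {r : ℝ} (hr : 0 < r) {t : ℝ}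
    (ht : 0 < t) (h : rearrInt m (ePow f r) (Ioo 0 t) < ∞) :
    decrRearr m (fun x => ‖f x‖ₑ) t < ∞ := by
  have hmul := ((mul_decrRearr_le_rearrInt_Ioo t).trans_lt h).ne
  rw [← ENNReal.rpow_lt_top_iff_of_pos hr, ← decrRearr_ePow f hr]
  exact ENNReal.lt_top_of_mul_ne_top_right hmul (ENNReal.ofReal_pos.2 ht).ne'

lemma decrRearr_enorm_lt_top_of_rearrInt_Ioi {f : Ω →ₘ[m] 𝕜} {r : ℝ} (hr : 0 < r) {T : ℝ}
    (hT : 0 < T) (h : rearrInt m (ePow f r) (Ioi T) < ∞) {t : ℝ} (ht : 0 < t) :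
    decrRearr m (fun x => ‖f x‖ₑ) t < ∞ := by
  have hmul := ((mul_decrRearr_le_rearrInt_Ioi T).trans_lt h).ne
  rw [← ENNReal.rpow_lt_top_iff_of_pos hr, ← decrRearr_ePow f hr]
  exact decrRearr_lt_top (measurable_ePow f r) (ePow_ne_top f hr.le)
    (ENNReal.lt_top_of_mul_ne_top_right hmul (ENNReal.ofReal_pos.2 hT).ne') ht

end Estimates

section Sums

variable {Ω : Type*} [MeasurableSpace Ω] {m : Measure Ω} {𝕜 : Type*} [RCLike 𝕜]
  {f : Ω →ₘ[m] 𝕜} {p q : ℝ≥0∞}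

lemma mem_sup_of_cutAbove_of_cutBelow {V W : Submodule 𝕜 (Ω →ₘ[m] 𝕜)} (b : ℝ≥0∞)
    (hV : cutAbove f b ∈ V) (hW : cutBelow f b ∈ W) : f ∈ V ⊔ W := by
  rw [← cutAbove_add_cutBelow f b]
  exact Submodule.add_mem_sup hV hW

lemma cutAbove_mem_lSpace_zero {t : ℝ} :
    cutAbove f (decrRearr m (fun x => ‖f x‖ₑ) t) ∈ lSpace 𝕜 m 0 := by
  rw [mem_lSpace_iff, lGauge_zero]
  exact (measure_support_cutAbove_le f _).trans_lt
    ((measure_decrRearr_lt_le t).trans_lt ENNReal.ofReal_lt_top)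

lemma cutAbove_mem_lSpace [SFinite m] (h0 : p ≠ 0) (ht : p ≠ ∞) {t : ℝ}
    (h : rearrInt m (ePow f p.toReal) (Ioo 0 t) < ∞) :
    cutAbove f (decrRearr m (fun x => ‖f x‖ₑ) t) ∈ lSpace 𝕜 m p := by
  rw [mem_lSpace_iff_lintegral h0 ht]
  exact (lintegral_ePow_cutAbove_le f (ENNReal.toReal_pos h0 ht) t).trans_lt h

lemma cutBelow_mem_lSpace [SFinite m] (h0 : q ≠ 0) (hq : q ≠ ∞) {T : ℝ} (hT : 0 < T)
    (h : rearrInt m (ePow f q.toReal) (Ioi T) < ∞) {t : ℝ} (ht : 0 < t) :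
    cutBelow f (decrRearr m (fun x => ‖f x‖ₑ) t) ∈ lSpace 𝕜 m q := by
  have hq' := ENNReal.toReal_pos h0 hq
  rw [mem_lSpace_iff_lintegral h0 hq]
  refine (lintegral_ePow_cutBelow_le f hq' _ hT.le).trans_lt (ENNReal.add_lt_top.2 ⟨?_, h⟩)
  exact ENNReal.mul_lt_top ENNReal.ofReal_lt_top (ENNReal.rpow_lt_top_of_nonneg hq'.le
    (decrRearr_enorm_lt_top_of_rearrInt_Ioi hq' hT h ht).ne)

lemma mem_sup_top_of_rearrInt_Ioo_lt_top [SFinite m] (h0 : p ≠ 0) (hp : p ≠ ∞) {t : ℝ} (ht : 0 < t)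
    (h : rearrInt m (ePow f p.toReal) (Ioo 0 t) < ∞) : f ∈ lSpace 𝕜 m p ⊔ lSpace 𝕜 m ∞ :=
  mem_sup_of_cutAbove_of_cutBelow _ (cutAbove_mem_lSpace h0 hp h) <|
    (lGauge_top_le (enorm_cutBelow_le f _)).trans_lt
      (decrRearr_enorm_lt_top_of_rearrInt_Ioo (ENNReal.toReal_pos h0 hp) ht h)

lemma mem_zero_sup_of_rearrInt_Ioi_lt_top [SFinite m] (h0 : q ≠ 0) (hq : q ≠ ∞) {T : ℝ} (hT : 0 < T)
    (h : rearrInt m (ePow f q.toReal) (Ioi T) < ∞) : f ∈ lSpace 𝕜 m 0 ⊔ lSpace 𝕜 m q :=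
  mem_sup_of_cutAbove_of_cutBelow _ cutAbove_mem_lSpace_zero (cutBelow_mem_lSpace h0 hq hT h hT)

lemma mem_sup_of_rearrInt_lt_top [SFinite m] (hp0 : p ≠ 0) (hp : p ≠ ∞) (hq0 : q ≠ 0)
    (hq : q ≠ ∞) {t T : ℝ} (ht : 0 < t) (hT : 0 < T)
    (hhead : rearrInt m (ePow f p.toReal) (Ioo 0 t) < ∞)
    (htail : rearrInt m (ePow f q.toReal) (Ioi T) < ∞) : f ∈ lSpace 𝕜 m p ⊔ lSpace 𝕜 m q :=
  mem_sup_of_cutAbove_of_cutBelow _ (cutAbove_mem_lSpace hp0 hp hhead)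
    (cutBelow_mem_lSpace hq0 hq hT htail ht)

end Sums

section FunctionSpace

variable {Ω : Type*} [MeasurableSpace Ω] {m : Measure Ω} {𝕜 : Type*} [RCLike 𝕜]
  {E : QuasiBanachFunctionSpace 𝕜 m} {J : ℝ → Set ℝ} {r : ℝ}

lemma exists_nrm_le_mul_cut_add_cut_compl (E : QuasiBanachFunctionSpace 𝕜 m) :
    ∃ K : ℝ, 0 ≤ K ∧ ∀ (f : Ω →ₘ[m] 𝕜) {S : Set Ω} (hS : MeasurableSet S),
      cut f hS ∈ E.carrier → cut f hS.compl ∈ E.carrier →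
        f ∈ E.carrier ∧ E.nrm f ≤ K * (E.nrm (cut f hS) + E.nrm (cut f hS.compl)) := by
  obtain ⟨K, hK⟩ := E.nrm_add_le
  refine ⟨max K 0, le_max_right _ _, fun f S hS h₁ h₂ => ?_⟩
  have hsum := cut_add_cut_compl f hS
  have hmem := E.carrier.add_mem h₁ h₂
  have hnrm := hK _ h₁ _ h₂
  rw [hsum] at hmem hnrm
  refine ⟨hmem, hnrm.trans ?_⟩
  gcongr
  · exact add_nonneg (E.nrm_nonneg _ h₁) (E.nrm_nonneg _ h₂)
  · exact le_max_left _ _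

lemma exists_enorm_rpow_eq (𝕜 : Type*) [RCLike 𝕜] {r : ℝ} (hr : 0 < r) {κ : ℝ≥0∞} (hκ : κ ≠ ∞) :
    ∃ a : 𝕜, ‖a‖ₑ ^ r = κ := by
  refine ⟨((κ ^ r⁻¹).toReal : 𝕜), ?_⟩
  have hfin : κ ^ r⁻¹ ≠ ∞ := ENNReal.rpow_ne_top_of_nonneg (inv_nonneg.2 hr.le) hκ
  rw [← ofReal_norm, RCLike.norm_ofReal, abs_of_nonneg ENNReal.toReal_nonneg,
    ENNReal.ofReal_toReal hfin, ENNReal.rpow_inv_rpow hr.ne']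

lemma ePow_cut_one {A : Set Ω} (hA : MeasurableSet A) (hr : 0 < r) :
    ePow (cut (1 : Ω →ₘ[m] 𝕜) hA) r =ᵐ[m] A.indicator fun _ => 1 := by
  filter_upwards [ePow_cut (1 : Ω →ₘ[m] 𝕜) hA hr, AEEqFun.coeFn_one (μ := m) (β := 𝕜)]
    with x hcut hone
  rw [hcut]
  by_cases hx : x ∈ A <;> simp [hx, ePow, hone]

lemma exists_one_lt_mul_norm [SigmaFinite m] {f : Ω →ₘ[m] 𝕜} (hf : f ≠ 0) :
    ∃ (N : ℝ) (A : Set Ω), 0 ≤ N ∧ MeasurableSet A ∧ m A ≠ 0 ∧ m A ≠ ∞ ∧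
      ∀ x ∈ A, 1 < N * ‖f x‖ := by
  have hex : ∃ n : ℕ, m {x | 1 < (n : ℝ) * ‖f x‖} ≠ 0 := by
    by_contra! hzero
    refine hf (AEEqFun.ext ?_)
    have hae : ∀ᵐ x ∂m, ∀ n : ℕ, (n : ℝ) * ‖f x‖ ≤ 1 :=
      ae_all_iff.2 fun n => ae_iff.2 (by simpa only [not_le] using hzero n)
    filter_upwards [hae, AEEqFun.coeFn_zero (μ := m) (β := 𝕜)] with x hx h0
    rw [h0, Pi.zero_apply, ← norm_le_zero_iff]
    by_contra! hpos
    obtain ⟨n, hn⟩ := exists_nat_gt ‖f x‖⁻¹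
    exact (hx n).not_gt ((inv_lt_iff_one_lt_mul₀ hpos).1 hn)
  obtain ⟨n, hn⟩ := hex
  obtain ⟨A, hA, hsub, hpos, hfin⟩ := Measure.exists_subset_measure_lt_top
    (measurableSet_lt measurable_const (f.stronglyMeasurable.measurable.norm.const_mul (n : ℝ)))
    (pos_iff_ne_zero.2 hn)
  exact ⟨n, A, n.cast_nonneg, hA, hpos.ne', hfin.ne, hsub⟩

lemma exists_cut_one_mem [SigmaFinite m] (hE : E.carrier ≠ ⊥) :
    ∃ (A : Set Ω) (hA : MeasurableSet A), m A ≠ 0 ∧ m A ≠ ∞ ∧ cut 1 hA ∈ E.carrier ∧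
      0 < E.nrm (cut 1 hA) := by
  obtain ⟨f, hf, hf0⟩ := (Submodule.ne_bot_iff _).1 hE
  obtain ⟨N, A, hN, hA, hA0, hAt, hNf⟩ := exists_one_lt_mul_norm hf0
  have hmem : cut 1 hA ∈ E.carrier := by
    refine (E.ideal _ (E.carrier.smul_mem (N : 𝕜) hf) _ ?_).1
    filter_upwards [coeFn_cut (1 : Ω →ₘ[m] 𝕜) hA, AEEqFun.coeFn_one (μ := m) (β := 𝕜),
      AEEqFun.coeFn_smul (N : 𝕜) f] with x hcut hone hsmul
    rw [hcut, hsmul, Pi.smul_apply, norm_smul, RCLike.norm_ofReal, abs_of_nonneg hN]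
    by_cases hx : x ∈ A
    · simpa [hx, hone] using (hNf x hx).le
    · simpa [hx] using mul_nonneg hN (norm_nonneg (f x))
  refine ⟨A, hA, hA0, hAt, hmem, (E.nrm_nonneg _ hmem).lt_of_ne' fun hnrm => hA0 ?_⟩
  calc m A = ∫⁻ x, ePow (cut (1 : Ω →ₘ[m] 𝕜) hA) 1 x ∂m := by
        rw [lintegral_congr_ae (ePow_cut_one hA one_pos), lintegral_indicator_const hA, one_mul]
    _ = ∫⁻ _, 0 ∂m := by
        rw [(E.nrm_eq_zero_iff _ hmem).1 hnrm]
        refine lintegral_congr_ae ?_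
        filter_upwards [AEEqFun.coeFn_zero (μ := m) (β := 𝕜)] with x h0
        simp [ePow, h0]
    _ = 0 := lintegral_zero

/-- Stability of `E` under majorization of `|·|^r`: domination of the rearrangement integrals over
all the sets `J t`, `t > 0`, implies domination in `E` up to a constant. The choices
`J t = (0, t)` and `J t = (t, ∞)` correspond to head and tail majorization. -/
def MajStable (E : QuasiBanachFunctionSpace 𝕜 m) (J : ℝ → Set ℝ) (r : ℝ) : Prop :=
  ∃ c : ℝ, 0 ≤ c ∧ ∀ f ∈ E.carrier, ∀ g : Ω →ₘ[m] 𝕜,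
    (∃ T, 0 < T ∧ rearrInt m (ePow f r) (J T) < ∞) →
    (∀ t, 0 < t → rearrInt m (ePow g r) (J t) ≤ rearrInt m (ePow f r) (J t)) →
    g ∈ E.carrier ∧ E.nrm g ≤ c * E.nrm f

lemma absPow_mem_one_sup_top [SFinite m] (f : Ω →ₘ[m] 𝕜) (hr : 0 ≤ r) {T : ℝ} (hT : 0 < T)
    (h : rearrInt m (ePow f r) (Ioo 0 T) < ∞) : absPow f r ∈ lSpace ℝ m 1 ⊔ lSpace ℝ m ∞ := by
  refine mem_sup_top_of_rearrInt_Ioo_lt_top one_ne_zero ENNReal.one_ne_top hT ?_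
  rwa [ENNReal.toReal_one, rearrInt_congr (ePow_absPow f hr)]

lemma absPow_mem_zero_sup_one [SFinite m] (f : Ω →ₘ[m] 𝕜) (hr : 0 ≤ r) {T : ℝ} (hT : 0 < T)
    (h : rearrInt m (ePow f r) (Ioi T) < ∞) : absPow f r ∈ lSpace ℝ m 0 ⊔ lSpace ℝ m 1 := by
  refine mem_zero_sup_of_rearrInt_Ioi_lt_top one_ne_zero ENNReal.one_ne_top hT ?_
  rwa [ENNReal.toReal_one, rearrInt_congr (ePow_absPow f hr)]

lemma majStable_of_headMaj [SFinite m] {p : ℝ≥0∞} (h0 : p ≠ 0) (ht : p ≠ ∞)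
    (h : ∃ c : ℝ, 0 < c ∧ ∀ f ∈ E.carrier, ∀ g ∈ lSpace 𝕜 m p ⊔ lSpace 𝕜 m ∞,
      HeadMaj (absPow g p.toReal) (absPow f p.toReal) → g ∈ E.carrier ∧ E.nrm g ≤ c * E.nrm f) :
    MajStable E (Ioo 0) p.toReal := by
  obtain ⟨c, hc, h⟩ := h
  have hp : 0 ≤ p.toReal := ENNReal.toReal_nonneg
  refine ⟨c, hc.le, fun f hf g ⟨T, hT, hfT⟩ hgf => ?_⟩
  have hgT := (hgf T hT).trans_lt hfT
  refine h f hf g (mem_sup_top_of_rearrInt_Ioo_lt_top h0 ht hT hgT)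
    ⟨absPow_mem_one_sup_top g hp hT hgT, absPow_mem_one_sup_top f hp hT hfT, fun t ht => ?_⟩
  rw [rearrangement_absPow g hp, rearrangement_absPow f hp]
  exact hgf t ht

lemma majStable_of_tailMaj [SFinite m] {q : ℝ≥0∞} (h0 : q ≠ 0) (ht : q ≠ ∞)
    (h : ∃ c : ℝ, 0 < c ∧ ∀ f ∈ E.carrier, ∀ g ∈ lSpace 𝕜 m 0 ⊔ lSpace 𝕜 m q,
      TailMaj (absPow g q.toReal) (absPow f q.toReal) → g ∈ E.carrier ∧ E.nrm g ≤ c * E.nrm f) :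
    MajStable E Ioi q.toReal := by
  obtain ⟨c, hc, h⟩ := h
  have hq : 0 ≤ q.toReal := ENNReal.toReal_nonneg
  refine ⟨c, hc.le, fun f hf g ⟨T, hT, hfT⟩ hgf => ?_⟩
  have hgT := (hgf T hT).trans_lt hfT
  refine h f hf g (mem_zero_sup_of_rearrInt_Ioi_lt_top h0 ht hT hgT)
    ⟨absPow_mem_zero_sup_one g hq hT hgT, absPow_mem_zero_sup_one f hq hT hfT, fun t ht => ?_⟩
  rw [rearrangement_absPow g hq, rearrangement_absPow f hq]
  exact hgf t ht

lemma rearrInt_smul_cut_one (a : 𝕜) {A : Set Ω} (hA : MeasurableSet A) (hr : 0 < r) (I : Set ℝ) :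
    rearrInt m (ePow (a • cut (1 : Ω →ₘ[m] 𝕜) hA) r) I =
      ‖a‖ₑ ^ r * rearrInt m (A.indicator fun _ => 1) I := by
  have hpow := ENNReal.rpow_ne_top_of_nonneg hr.le (enorm_ne_top (x := a))
  rw [rearrInt_congr (ePow_smul a _ hr.le), rearrInt_const_mul hpow,
    rearrInt_congr (ePow_cut_one hA hr)]

lemma rearrInt_cut_one {A : Set Ω} (hA : MeasurableSet A) (hr : 0 < r) (I : Set ℝ) :
    rearrInt m (ePow (cut (1 : Ω →ₘ[m] 𝕜) hA) r) I = rearrInt m (A.indicator fun _ => 1) I := by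
  rw [rearrInt_congr (ePow_cut_one hA hr)]

lemma exists_truncation_bound [SigmaFinite m] (f : Ω →ₘ[m] 𝕜) (hr : 0 ≤ r) :
    ∃ S : ℕ → Set Ω, (∀ n, MeasurableSet (S n)) ∧ Monotone S ∧ (∀ x, ∃ n, x ∈ S n) ∧
      ∀ n, ∫⁻ x in S n, ePow f r x ∂m < ∞ := by
  refine ⟨fun n => {x | ePow f r x ≤ n} ∩ spanningSets m n,
    fun n => (measurableSet_le (measurable_ePow f r) measurable_const).inter
      (measurableSet_spanningSets m n),
    fun i j hij => inter_subset_inter (fun x (hx : ePow f r x ≤ i) => hx.trans (Nat.cast_le.2 hij))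
      (monotone_spanningSets m hij), fun x => ?_, fun n => ?_⟩
  · obtain ⟨n, hn⟩ := ENNReal.exists_nat_gt (ePow_ne_top f hr x)
    obtain ⟨k, hk⟩ := mem_iUnion.1 ((iUnion_spanningSets m).symm ▸ mem_univ x)
    exact ⟨max n k, hn.le.trans (Nat.cast_le.2 (le_max_left n k)),
      monotone_spanningSets m (le_max_right n k) hk⟩
  · calc ∫⁻ x in {x | ePow f r x ≤ n} ∩ spanningSets m n, ePow f r x ∂m
        ≤ ∫⁻ _ in {x | ePow f r x ≤ n} ∩ spanningSets m n, (n : ℝ≥0∞) ∂m :=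
          setLIntegral_mono measurable_const fun x hx => hx.1
      _ = n * m ({x | ePow f r x ≤ n} ∩ spanningSets m n) := setLIntegral_const _ _
      _ < ∞ := ENNReal.mul_lt_top (ENNReal.natCast_lt_top n)
          ((measure_mono inter_subset_right).trans_lt (measure_spanningSets_lt_top m n))

lemma rearrInt_le_of_forall_cut_le {f : Ω →ₘ[m] 𝕜} (hr : 0 < r) {S : ℕ → Set Ω}
    (hS : ∀ n, MeasurableSet (S n)) (hmono : Monotone S) (hcover : ∀ x, ∃ n, x ∈ S n)
    {I : Set ℝ} {B : ℝ≥0∞} (h : ∀ n, rearrInt m (ePow (cut f (hS n)) r) I ≤ B) :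
    rearrInt m (ePow f r) I ≤ B := by
  have hsup : ePow f r = fun x => ⨆ n, (S n).indicator (ePow f r) x := by
    funext x
    obtain ⟨n, hn⟩ := hcover x
    refine le_antisymm (le_iSup_of_le n (indicator_of_mem hn _).ge) ?_
    exact iSup_le fun k => indicator_le_self _ _ _
  rw [hsup, rearrInt_iSup fun i j hij => indicator_le_indicator_of_subset (hmono hij)
    fun _ => zero_le]
  refine iSup_le fun n => ?_
  rw [← rearrInt_congr (ePow_cut f (hS n) hr)]
  exact h n

/-- Testing on multiples of the indicator of a set `A` of measure `α`: the hypothesis `hJ` says that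
the multiple whose rearrangement has the same integral over `J α` as `F` is majorized by `F`. -/
lemma MajStable.exists_rearrInt_lt_top [SigmaFinite m] (hstab : MajStable E J r)
    (hE : E.carrier ≠ ⊥) (hr : 0 < r) (hJ0 : ∀ t, 0 < t → J t ⊆ Ioi 0)
    (hJ : ∀ (F : Ω → ℝ≥0∞) (A : Set Ω) (t : ℝ), 0 < t → m A ≠ ∞ →
      rearrInt m F (J (m A).toReal) * rearrInt m (A.indicator fun _ => 1) (J t) ≤
        m A * rearrInt m F (J t)) :
    ∃ T, 0 < T ∧ ∀ f ∈ E.carrier, rearrInt m (ePow f r) (J T) < ∞ := by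
  obtain ⟨A, hA, hA0, hAt, hmem, hpos⟩ := exists_cut_one_mem hE
  obtain ⟨c, hc, hstab⟩ := hstab
  have hα := ENNReal.toReal_pos hA0 hAt
  refine ⟨(m A).toReal, hα, fun f hf => ?_⟩
  obtain ⟨S, hS, hmono, hcover, hSfin⟩ := exists_truncation_bound f hr.le
  refine (rearrInt_le_of_forall_cut_le hr hS hmono hcover (fun n => ?_)).trans_lt
    (b := m A * ENNReal.ofReal (c * E.nrm f / E.nrm (cut 1 hA)) ^ r)
    (ENNReal.mul_lt_top hAt.lt_top (ENNReal.rpow_lt_top_of_nonneg hr.le ENNReal.ofReal_ne_top))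
  obtain ⟨hcutE, hcut⟩ := E.ideal f hf _ (norm_cut_le f (hS n))
  set h := cut f (hS n)
  have hfin : rearrInt m (ePow h r) (J (m A).toReal) < ∞ :=
    (rearrInt_le_lintegral (measurable_ePow h r) (hJ0 _ hα)).trans_lt
      ((lintegral_ePow_cut f (hS n) hr).trans_lt (hSfin n))
  obtain ⟨a, ha⟩ := exists_enorm_rpow_eq 𝕜 hr (ENNReal.div_ne_top hfin.ne hA0)
  have htest := (hstab h hcutE (a • cut 1 hA) ⟨_, hα, hfin⟩ fun t ht => ?_).2
  · rw [E.nrm_smul a _ hmem] at htest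
    have hanorm : ‖a‖ ≤ c * E.nrm f / E.nrm (cut 1 hA) :=
      (le_div_iff₀ hpos).2 (htest.trans (mul_le_mul_of_nonneg_left hcut hc))
    rw [← ENNReal.mul_div_cancel hA0 hAt (b := rearrInt m (ePow h r) (J (m A).toReal)), ← ha,
      ← ofReal_norm]
    gcongr
  · rw [rearrInt_smul_cut_one a hA hr, ha, ENNReal.mul_comm_div, ← mul_div_assoc]
    exact ENNReal.div_le_of_le_mul' (hJ _ A t ht hAt)

lemma MajStable.exists_rearrInt_Ioo_lt_top [SigmaFinite m] (hstab : MajStable E (Ioo 0) r)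
    (hE : E.carrier ≠ ⊥) (hr : 0 < r) :
    ∃ T, 0 < T ∧ ∀ f ∈ E.carrier, rearrInt m (ePow f r) (Ioo 0 T) < ∞ := by
  refine hstab.exists_rearrInt_lt_top hE hr (fun t _ => Ioo_subset_Ioi_self) fun F A t _ hA => ?_
  rw [rearrInt_Ioo_indicator_const, one_mul, mul_comm]
  rcases le_total t (m A).toReal with hle | hge
  · refine (mul_le_mul_left (min_le_left _ _) _).trans ?_
    refine (mul_rearrInt_Ioo_le_mul_rearrInt_Ioo hle).trans_eq ?_
    rw [ENNReal.ofReal_toReal hA]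
  · gcongr
    · exact min_le_right _ _
    · exact rearrInt_mono_set (Ioo_subset_Ioo_right hge)

lemma MajStable.exists_rearrInt_Ioi_lt_top [SigmaFinite m] (hstab : MajStable E Ioi r)
    (hE : E.carrier ≠ ⊥) (hr : 0 < r) :
    ∃ T, 0 < T ∧ ∀ f ∈ E.carrier, rearrInt m (ePow f r) (Ioi T) < ∞ := by
  refine hstab.exists_rearrInt_lt_top hE hr (fun t ht => Ioi_subset_Ioi ht.le) fun F A t ht hA => ?_
  rw [rearrInt_Ioi_indicator_const A 1 ht.le, one_mul, mul_comm]
  rcases le_total t (m A).toReal with hle | hge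
  · gcongr
    · exact tsub_le_self
    · exact rearrInt_mono_set (Ioi_subset_Ioi hle)
  · rw [tsub_eq_zero_of_le ((ENNReal.le_ofReal_iff_toReal_le hA ht.le).2 hge), zero_mul]
    exact zero_le

lemma MajStable.exists_bound (hstab : MajStable E J r) (hr : 0 < r)
    (hfin : ∃ T, 0 < T ∧ ∀ f ∈ E.carrier, rearrInt m (ePow f r) (J T) < ∞) {κ : ℝ≥0∞} (hκ : κ ≠ ∞) :
    ∃ c : ℝ, 0 ≤ c ∧ ∀ f ∈ E.carrier, ∀ g : Ω →ₘ[m] 𝕜,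
      (∀ t, 0 < t → rearrInt m (ePow g r) (J t) ≤ κ * rearrInt m (ePow f r) (J t)) →
      g ∈ E.carrier ∧ E.nrm g ≤ c * E.nrm f := by
  obtain ⟨c, hc, hstab⟩ := hstab
  obtain ⟨T, hT, hfin⟩ := hfin
  obtain ⟨a, ha⟩ := exists_enorm_rpow_eq 𝕜 hr hκ
  refine ⟨c * ‖a‖, by positivity, fun f hf g hgf => ?_⟩
  have haf := E.carrier.smul_mem a hf
  have hscale (t : ℝ) : rearrInt m (ePow (a • f) r) (J t) = κ * rearrInt m (ePow f r) (J t) := by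
    rw [rearrInt_congr (ePow_smul a f hr.le), ha, rearrInt_const_mul hκ]
  have := hstab (a • f) haf g ⟨T, hT, hfin _ haf⟩ fun t ht => (hgf t ht).trans_eq (hscale t).symm
  rwa [E.nrm_smul a f hf, ← mul_assoc] at this

end FunctionSpace

section Inclusions

variable {Ω : Type*} [MeasurableSpace Ω] {m : Measure Ω} {𝕜 : Type*} [RCLike 𝕜]
  {E : QuasiBanachFunctionSpace 𝕜 m} {p q : ℝ≥0∞}

lemma MajStable.lSpace_inf_top_le [SigmaFinite m] (hp0 : p ≠ 0) (hp : p ≠ ∞)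
    (hstab : MajStable E (Ioo 0) p.toReal) (hE : E.carrier ≠ ⊥) :
    lSpace 𝕜 m p ⊓ lSpace 𝕜 m ∞ ≤ E.carrier := by
  rintro f ⟨hfp, hft⟩
  obtain ⟨A, hA, hA0, hAt, hmem, -⟩ := exists_cut_one_mem hE
  have hr := ENNReal.toReal_pos hp0 hp
  have hint : ∫⁻ x, ePow f p.toReal x ∂m ≠ ∞ := ((mem_lSpace_iff_lintegral hp0 hp).1 hfp).ne
  set b := lGauge ∞ f ^ p.toReal
  have hb : b ≠ ∞ := ENNReal.rpow_ne_top_of_nonneg hr.le (mem_lSpace_iff.1 hft).ne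
  have hdiv := ENNReal.div_ne_top hint hA0
  obtain ⟨c, -, hbound⟩ := hstab.exists_bound hr (hstab.exists_rearrInt_Ioo_lt_top hE hr)
    (ENNReal.add_ne_top.2 ⟨hb, hdiv⟩)
  refine (hbound _ hmem f fun t _ => ?_).1
  rw [rearrInt_cut_one hA hr, rearrInt_Ioo_indicator_const, one_mul, mul_min]
  refine le_min ?_ ?_
  · have hzero : ∫⁻ x, (ePow f p.toReal x - b) ∂m = 0 := by
      rw [← lintegral_zero (μ := m)]
      refine lintegral_congr_ae ?_
      filter_upwards [ae_enorm_le_lGauge_top f] with x hx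
      exact tsub_eq_zero_of_le (ENNReal.rpow_le_rpow hx hr.le)
    refine (rearrInt_Ioo_le_add (measurable_ePow _ _) b t).trans ?_
    rw [hzero, zero_add, mul_comm]
    gcongr
    exact le_self_add
  · refine (rearrInt_le_lintegral (measurable_ePow _ _) Ioo_subset_Ioi_self).trans ?_
    rw [add_mul, ENNReal.div_mul_cancel hA0 hAt]
    exact le_add_self

lemma mem_lSpace_of_norm_le {f g : Ω →ₘ[m] 𝕜} (hf : f ∈ lSpace 𝕜 m p)
    (h : ∀ᵐ x ∂m, ‖g x‖ ≤ ‖f x‖) : g ∈ lSpace 𝕜 m p := by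
  rw [mem_lSpace_iff] at hf ⊢
  refine lt_of_le_of_lt ?_ hf
  unfold lGauge
  split_ifs
  · refine measure_mono_ae ?_
    filter_upwards [h] with x hx hgx hfx
    exact hgx (norm_le_zero_iff.1 (hx.trans_eq (by rw [hfx, norm_zero])))
  · exact eLpNorm_mono_ae h

lemma lSpace_inf_le_sup_inf_zero_inf_top (hp0 : p ≠ 0) (hp : p ≠ ∞) :
    lSpace 𝕜 m p ⊓ lSpace 𝕜 m q ≤
      (lSpace 𝕜 m 0 ⊓ lSpace 𝕜 m q) ⊔ (lSpace 𝕜 m p ⊓ lSpace 𝕜 m ∞) := by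
  rintro f ⟨hfp, hfq⟩
  refine mem_sup_of_cutAbove_of_cutBelow 1
    ⟨?_, mem_lSpace_of_norm_le hfq (norm_cut_le f _)⟩ ⟨mem_lSpace_of_norm_le hfp (norm_cut_le f _),
      (lGauge_top_le (enorm_cutBelow_le f 1)).trans_lt ENNReal.one_lt_top⟩
  refine (lGauge_zero _).trans_lt ?_
  refine ((measure_support_cutAbove_le f 1).trans (measure_lt_enorm_le_of_lintegral_le f
    (ENNReal.toReal_pos hp0 hp) ?_)).trans_lt ((mem_lSpace_iff_lintegral hp0 hp).1 hfp)
  rw [ENNReal.one_rpow, mul_one]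

end Inclusions

section Operators

variable {Ω : Type*} [MeasurableSpace Ω] {m : Measure Ω} {𝕜 : Type*} [RCLike 𝕜]
  {f g : Ω →ₘ[m] 𝕜} {p q : ℝ≥0∞} {K : ℝ≥0} {u : ℝ}

/-- The trace left on a pair `(f, g = T f)` by an operator `T` which is bounded on `L_p` and on
`L_q` with constant `K`: every splitting of `f` in `L_p + L_q` induces a splitting of `g` with
control of both parts. -/
def SplitDominated (p q : ℝ≥0∞) (K : ℝ≥0) (f g : Ω →ₘ[m] 𝕜) : Prop :=
  ∀ f₀ ∈ lSpace 𝕜 m p, ∀ f₁ ∈ lSpace 𝕜 m q, f = f₀ + f₁ → ∃ g₀ g₁, g = g₀ + g₁ ∧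
    lGauge p g₀ ≤ K * lGauge p f₀ ∧ lGauge q g₁ ≤ K * lGauge q f₁

lemma exists_splitDominated
    {T : ↥(lSpace 𝕜 m p ⊔ lSpace 𝕜 m q) →ₗ[𝕜] ↥(lSpace 𝕜 m p ⊔ lSpace 𝕜 m q)}
    (hp : BoundedOnL T p) (hq : BoundedOnL T q) :
    ∃ K : ℝ≥0, 0 < K ∧ ∀ f : ↥(lSpace 𝕜 m p ⊔ lSpace 𝕜 m q),
      SplitDominated p q K (f : Ω →ₘ[m] 𝕜) (T f) := by
  obtain ⟨C, hC⟩ := hp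
  obtain ⟨D, hD⟩ := hq
  refine ⟨C + D + 1, by positivity, fun f f₀ hf₀ f₁ hf₁ hf => ?_⟩
  let F₀ : ↥(lSpace 𝕜 m p ⊔ lSpace 𝕜 m q) := ⟨f₀, le_sup_left (a := lSpace 𝕜 m p) hf₀⟩
  let F₁ : ↥(lSpace 𝕜 m p ⊔ lSpace 𝕜 m q) := ⟨f₁, le_sup_right (b := lSpace 𝕜 m q) hf₁⟩
  have hF : f = F₀ + F₁ := Subtype.ext hf
  refine ⟨T F₀, T F₁, by rw [hF, map_add]; rfl, (hC F₀ hf₀).2.trans ?_, (hD F₁ hf₁).2.trans ?_⟩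
  · gcongr
    exact_mod_cast (le_add_right le_self_add : C ≤ C + D + 1)
  · gcongr
    exact_mod_cast (le_add_right le_add_self : D ≤ C + D + 1)

lemma isInterpolationSpace_of_splitDominated {E : QuasiBanachFunctionSpace 𝕜 m}
    (hinf : lSpace 𝕜 m p ⊓ lSpace 𝕜 m q ≤ E.carrier)
    (hsup : E.carrier ≤ lSpace 𝕜 m p ⊔ lSpace 𝕜 m q)
    (h : ∀ K : ℝ≥0, 0 < K → ∃ c : ℝ, ∀ f ∈ E.carrier, ∀ g, SplitDominated p q K f g →
      g ∈ E.carrier ∧ E.nrm g ≤ c * E.nrm f) : IsInterpolationSpace E p q := by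
  refine ⟨hinf, hsup, fun T hTp hTq => ?_⟩
  obtain ⟨K, hK, hsplit⟩ := exists_splitDominated hTp hTq
  obtain ⟨c, hc⟩ := h K hK
  exact ⟨c, fun f hf => hc f hf _ (hsplit f)⟩

lemma rearrInt_Ioi_add_le_of_lintegral_le [SFinite m] (g₀ g₁ : Ω →ₘ[m] 𝕜) {p q : ℝ} (hp : 0 < p)
    (hpq : p ≤ q) (hu : 0 ≤ u) {b : ℝ≥0∞}
    (h : ∫⁻ x, ePow g₀ p x ∂m ≤ ENNReal.ofReal u * b ^ p) :
    rearrInt m (ePow (g₀ + g₁) q) (Ioi u) ≤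
      2 ^ q * (ENNReal.ofReal u * b ^ q + ∫⁻ x, ePow g₁ q x ∂m) := by
  have hsmall := measure_lt_enorm_le_of_lintegral_le g₀ hp h
  refine (rearrInt_Ioi_ePow_add_le g₀ g₁ (hp.trans_le hpq) hu hsmall).trans ?_
  gcongr
  calc ∫⁻ x in {x | b < ‖g₀ x‖ₑ}ᶜ, ePow g₀ q x ∂m
      ≤ b ^ (q - p) * (ENNReal.ofReal u * b ^ p) :=
        (setLIntegral_ePow_le_mul_lintegral g₀ hp hpq b).trans (by gcongr)
    _ = ENNReal.ofReal u * b ^ q := by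
        rw [mul_left_comm, ← ENNReal.rpow_add_of_nonneg _ _ (sub_nonneg.2 hpq) hp.le,
          sub_add_cancel]

lemma rearrInt_Ioo_add_le_of_lintegral_le [SFinite m] (g₀ g₁ : Ω →ₘ[m] 𝕜) {p q : ℝ} (hp : 0 < p)
    (hpq : p ≤ q) {b : ℝ≥0∞} (hb0 : b ≠ 0) (hb : b ≠ ∞)
    (h₀ : ∫⁻ x, ePow g₀ p x ∂m ≤ ENNReal.ofReal u * b ^ p)
    (h₁ : ∫⁻ x, ePow g₁ q x ∂m ≤ 2 * (ENNReal.ofReal u * b ^ q)) :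
    rearrInt m (ePow (g₀ + g₁) p) (Ioo 0 u) ≤ 2 ^ p * 4 * (ENNReal.ofReal u * b ^ p) := by
  set U := ENNReal.ofReal u
  have hexcess : ∫⁻ x, (ePow g₁ p x - b ^ p) ∂m ≤ 2 * (U * b ^ p) :=
    calc ∫⁻ x, (ePow g₁ p x - b ^ p) ∂m ≤ b ^ (p - q) * (2 * (U * b ^ q)) :=
          (lintegral_ePow_sub_le_mul_lintegral g₁ hp hpq hb0).trans (by gcongr)
      _ = 2 * (U * b ^ p) := by
          rw [mul_left_comm, mul_left_comm (b ^ (p - q)), ← ENNReal.rpow_add _ _ hb0 hb,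
            sub_add_cancel]
  calc rearrInt m (ePow (g₀ + g₁) p) (Ioo 0 u)
      ≤ 2 ^ p * (U * b ^ p + 2 * (U * b ^ p) + U * b ^ p) :=
        (rearrInt_Ioo_ePow_add_le g₀ g₁ hp b u).trans (by gcongr)
    _ = 2 ^ p * 4 * (U * b ^ p) := by ring

lemma SplitDominated.exists_lintegral_le [SFinite m] (h : SplitDominated p q K f g) (hp0 : p ≠ 0)
    (hp : p ≠ ∞) (hq0 : q ≠ 0) (hq : q ≠ ∞) (hu : 0 < u)
    (hhead : rearrInt m (ePow f p.toReal) (Ioo 0 u) < ∞)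
    (htail : rearrInt m (ePow f q.toReal) (Ioi u) < ∞) :
    ∃ g₀ g₁, g = g₀ + g₁ ∧
      ∫⁻ x, ePow g₀ p.toReal x ∂m ≤ K ^ p.toReal * rearrInt m (ePow f p.toReal) (Ioo 0 u) ∧
      ∫⁻ x, ePow g₁ q.toReal x ∂m ≤ K ^ q.toReal *
        (ENNReal.ofReal u * decrRearr m (fun x => ‖f x‖ₑ) u ^ q.toReal +
          rearrInt m (ePow f q.toReal) (Ioi u)) := by
  obtain ⟨g₀, g₁, hg, hg₀, hg₁⟩ := h _ (cutAbove_mem_lSpace hp0 hp hhead) _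
    (cutBelow_mem_lSpace hq0 hq hu htail hu) (cutAbove_add_cutBelow f _).symm
  refine ⟨g₀, g₁, hg, (lintegral_ePow_le_of_lGauge_le hp0 hp hg₀).trans ?_,
    (lintegral_ePow_le_of_lGauge_le hq0 hq hg₁).trans ?_⟩
  · gcongr
    exact lintegral_ePow_cutAbove_le f (ENNReal.toReal_pos hp0 hp) u
  · gcongr
    exact lintegral_ePow_cutBelow_le f (ENNReal.toReal_pos hq0 hq) _ hu.le

/-- The mean `α = ((1/u) ∫₀ᵘ (f*)^r)^{1/r}` of `f*` over `(0, u)` is at least `f*(u)`. -/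
lemma exists_mul_rpow_eq_rearrInt_Ioo (f : Ω →ₘ[m] 𝕜) {r : ℝ} (hr : 0 < r) (hu : 0 < u)
    (hfin : rearrInt m (ePow f r) (Ioo 0 u) < ∞) :
    ∃ α : ℝ≥0∞, α ≠ ∞ ∧ decrRearr m (fun x => ‖f x‖ₑ) u ≤ α ∧
      ENNReal.ofReal u * α ^ r = rearrInt m (ePow f r) (Ioo 0 u) := by
  have hU : ENNReal.ofReal u ≠ 0 := (ENNReal.ofReal_pos.2 hu).ne'
  have hα : ENNReal.ofReal u * ((rearrInt m (ePow f r) (Ioo 0 u) / ENNReal.ofReal u) ^ r⁻¹) ^ r =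
      rearrInt m (ePow f r) (Ioo 0 u) := by
    rw [ENNReal.rpow_inv_rpow hr.ne', ENNReal.mul_div_cancel hU ENNReal.ofReal_ne_top]
  refine ⟨_, ENNReal.rpow_ne_top_of_nonneg (inv_nonneg.2 hr.le) (ENNReal.div_ne_top hfin.ne hU),
    ?_, hα⟩
  rw [← ENNReal.rpow_le_rpow_iff hr, ← ENNReal.mul_le_mul_iff_right hU ENNReal.ofReal_ne_top, hα,
    ← decrRearr_ePow f hr]
  exact mul_decrRearr_le_rearrInt_Ioo u

lemma SplitDominated.rearrInt_Ioi_le_or_rearrInt_Ioo_le [SFinite m] (h : SplitDominated p q K f g)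
    (hp0 : p ≠ 0) (hpq : p < q) (hq : q ≠ ∞) (hK : 0 < K) (hu : 0 < u)
    (hhead : rearrInt m (ePow f p.toReal) (Ioo 0 u) < ∞) :
    rearrInt m (ePow g q.toReal) (Ioi u) ≤ 2 ^ q.toReal * (3 * (K : ℝ≥0∞) ^ q.toReal) *
        rearrInt m (ePow f q.toReal) (Ioi u) ∨
      rearrInt m (ePow g p.toReal) (Ioo 0 u) ≤ 2 ^ p.toReal * 4 * (K : ℝ≥0∞) ^ p.toReal *
        rearrInt m (ePow f p.toReal) (Ioo 0 u) := by
  have hP := ENNReal.toReal_pos hp0 hpq.ne_top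
  have hQ := ENNReal.toReal_pos hpq.ne_bot hq
  have hPQ : p.toReal ≤ q.toReal := ENNReal.toReal_mono hq hpq.le
  have hK0 : (K : ℝ≥0∞) ≠ 0 := ENNReal.coe_ne_zero.2 hK.ne'
  set Y := rearrInt m (ePow f q.toReal) (Ioi u)
  set U := ENNReal.ofReal u
  rcases eq_or_ne Y ∞ with hY | hY
  · refine Or.inl (le_top.trans_eq ?_)
    rw [hY, ENNReal.mul_top (by simp [hK0])]
  obtain ⟨g₀, g₁, rfl, hg₀, hg₁⟩ :=
    h.exists_lintegral_le hp0 hpq.ne_top hpq.ne_bot hq hu hhead hY.lt_top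
  obtain ⟨α, hαt, haα, hα⟩ := exists_mul_rpow_eq_rearrInt_Ioo f hP hu hhead
  have hscale (r : ℝ) (hr : 0 < r) : U * (K * α) ^ r = K ^ r * (U * α ^ r) := by
    rw [ENNReal.mul_rpow_of_nonneg _ _ hr.le, mul_left_comm]
  have h₀ : ∫⁻ x, ePow g₀ p.toReal x ∂m ≤ U * (K * α) ^ p.toReal := by rwa [hscale _ hP, hα]
  have h₁ : ∫⁻ x, ePow g₁ q.toReal x ∂m ≤ K ^ q.toReal * (U * α ^ q.toReal + Y) :=
    hg₁.trans (by gcongr)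
  rcases le_or_gt (U * α ^ q.toReal) Y with hcase | hcase
  · left
    calc rearrInt m (ePow (g₀ + g₁) q.toReal) (Ioi u)
        ≤ 2 ^ q.toReal * (U * (K * α) ^ q.toReal + ∫⁻ x, ePow g₁ q.toReal x ∂m) :=
          rearrInt_Ioi_add_le_of_lintegral_le g₀ g₁ hP hPQ hu.le h₀
      _ ≤ 2 ^ q.toReal * (K ^ q.toReal * Y + K ^ q.toReal * (Y + Y)) := by
          rw [hscale _ hQ]
          exact mul_le_mul_right (add_le_add (by gcongr) (h₁.trans (by gcongr))) _
      _ = 2 ^ q.toReal * (3 * K ^ q.toReal) * Y := by ring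
  · right
    have hα0 : α ≠ 0 := by
      rintro rfl
      simp [hQ] at hcase
    rw [mul_assoc _ (_ ^ _), ← hα, ← hscale _ hP]
    refine rearrInt_Ioo_add_le_of_lintegral_le g₀ g₁ hP hPQ (mul_ne_zero hK0 hα0)
      (ENNReal.mul_ne_top ENNReal.coe_ne_top hαt) h₀ ?_
    calc ∫⁻ x, ePow g₁ q.toReal x ∂m
        ≤ K ^ q.toReal * (U * α ^ q.toReal + U * α ^ q.toReal) := h₁.trans (by gcongr)
      _ = 2 * (U * (K * α) ^ q.toReal) := by rw [hscale _ hQ]; ring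

lemma SplitDominated.rearrInt_Ioo_le_of_top [SFinite m] (h : SplitDominated p ∞ K f g)
    (hp0 : p ≠ 0) (hp : p ≠ ∞) (hu : 0 < u)
    (hhead : rearrInt m (ePow f p.toReal) (Ioo 0 u) < ∞) :
    rearrInt m (ePow g p.toReal) (Ioo 0 u) ≤ 2 ^ p.toReal * (2 * (K : ℝ≥0∞) ^ p.toReal) *
      rearrInt m (ePow f p.toReal) (Ioo 0 u) := by
  have hP := ENNReal.toReal_pos hp0 hp
  set X := rearrInt m (ePow f p.toReal) (Ioo 0 u)
  set a := decrRearr m (fun x => ‖f x‖ₑ) u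
  have hbelow : lGauge ∞ (cutBelow f a) ≤ a := lGauge_top_le (enorm_cutBelow_le f a)
  obtain ⟨g₀, g₁, rfl, hg₀, hg₁⟩ := h _ (cutAbove_mem_lSpace hp0 hp hhead) _
    (hbelow.trans_lt (decrRearr_enorm_lt_top_of_rearrInt_Ioo hP hu hhead))
    (cutAbove_add_cutBelow f a).symm
  have h₀ : ∫⁻ x, ePow g₀ p.toReal x ∂m ≤ K ^ p.toReal * X :=
    (lintegral_ePow_le_of_lGauge_le hp0 hp hg₀).trans
      (mul_le_mul_right (lintegral_ePow_cutAbove_le f hP u) _)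
  have h₁ : ∫⁻ x, (ePow g₁ p.toReal x - (K * a) ^ p.toReal) ∂m = 0 := by
    rw [← lintegral_zero (μ := m)]
    refine lintegral_congr_ae ?_
    filter_upwards [ae_enorm_le_lGauge_top g₁] with x hx
    exact tsub_eq_zero_of_le (ENNReal.rpow_le_rpow
      (hx.trans (hg₁.trans (mul_le_mul_right hbelow _))) hP.le)
  have hlevel : ENNReal.ofReal u * (K * a) ^ p.toReal ≤ K ^ p.toReal * X := by
    rw [ENNReal.mul_rpow_of_nonneg _ _ hP.le, mul_left_comm, ← decrRearr_ePow f hP]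
    gcongr
    exact mul_decrRearr_le_rearrInt_Ioo u
  calc rearrInt m (ePow (g₀ + g₁) p.toReal) (Ioo 0 u)
      ≤ 2 ^ p.toReal * (K ^ p.toReal * X + 0 + K ^ p.toReal * X) := by
        refine (rearrInt_Ioo_ePow_add_le g₀ g₁ hP (K * a) u).trans ?_
        rw [h₁]
        gcongr
    _ = 2 ^ p.toReal * (2 * K ^ p.toReal) * X := by ring

lemma SplitDominated.rearrInt_Ioi_le_of_zero [SFinite m] (h : SplitDominated 0 q K f g)
    (hq0 : q ≠ 0) (hq : q ≠ ∞) (hK : 0 < K) (hu : 0 < u) :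
    rearrInt m (ePow g q.toReal) (Ioi (K * (2 * u))) ≤
      2 ^ q.toReal * (2 * (K : ℝ≥0∞) ^ q.toReal) * rearrInt m (ePow f q.toReal) (Ioi u) := by
  have hQ := ENNReal.toReal_pos hq0 hq
  have hK0 : (K : ℝ≥0∞) ≠ 0 := ENNReal.coe_ne_zero.2 hK.ne'
  set Y := rearrInt m (ePow f q.toReal) (Ioi u)
  set a := decrRearr m (fun x => ‖f x‖ₑ) (2 * u)
  rcases eq_or_ne Y ∞ with hY | hY
  · refine le_top.trans_eq ?_
    rw [hY, ENNReal.mul_top (by simp [hK0])]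
  obtain ⟨g₀, g₁, rfl, hg₀, hg₁⟩ := h _ cutAbove_mem_lSpace_zero _
    (cutBelow_mem_lSpace hq0 hq hu hY.lt_top (mul_pos two_pos hu)) (cutAbove_add_cutBelow f a).symm
  have hsupp : m {x | 0 < ‖g₀ x‖ₑ} ≤ ENNReal.ofReal (K * (2 * u)) := by
    rw [ENNReal.ofReal_mul K.coe_nonneg, ENNReal.ofReal_coe_nnreal]
    calc m {x | 0 < ‖g₀ x‖ₑ} = lGauge 0 g₀ := by simp only [lGauge_zero, enorm_pos]; rfl
      _ ≤ K * ENNReal.ofReal (2 * u) := hg₀.trans (mul_le_mul_right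
          ((lGauge_zero _).trans_le ((measure_support_cutAbove_le f a).trans
            (measure_decrRearr_lt_le _))) _)
  have hvanish : ∫⁻ x in {x | 0 < ‖g₀ x‖ₑ}ᶜ, ePow g₀ q.toReal x ∂m = 0 := by
    refine setLIntegral_eq_zero (measurableSet_lt_enorm g₀ 0).compl fun x hx => ?_
    rw [mem_compl_iff, mem_ofPred_eq, not_lt, nonpos_iff_eq_zero] at hx
    simp [ePow, hx, hQ]
  have hlevel : ENNReal.ofReal u * a ^ q.toReal ≤ Y := by
    rw [← decrRearr_ePow f hQ]
    exact mul_decrRearr_le_rearrInt_Ioi u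
  have h₁ : ∫⁻ x, ePow g₁ q.toReal x ∂m ≤ K ^ q.toReal * (Y + Y) :=
    (lintegral_ePow_le_of_lGauge_le hq0 hq hg₁).trans <| mul_le_mul_right
      ((lintegral_ePow_cutBelow_le f hQ a hu.le).trans (by gcongr)) _
  calc rearrInt m (ePow (g₀ + g₁) q.toReal) (Ioi (K * (2 * u)))
      ≤ 2 ^ q.toReal * (0 + K ^ q.toReal * (Y + Y)) := by
        refine (rearrInt_Ioi_ePow_add_le g₀ g₁ hQ (by positivity) hsupp).trans ?_
        rw [hvanish]
        gcongr
    _ = 2 ^ q.toReal * (2 * K ^ q.toReal) * Y := by ring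

end Operators

section HalfLine

instance nullSingletonClass_halfLine : NullSingletonClass halfLine := by
  unfold halfLine
  infer_instance

lemma setLIntegral_halfLine {S : Set ℝ} (hS : MeasurableSet S) (F : ℝ → ℝ≥0∞) :
    ∫⁻ x in S, F x ∂halfLine = ∫⁻ x in S ∩ Ioi 0, F x := by
  rw [halfLine, Measure.restrict_restrict hS]

lemma halfLine_apply_le (S : Set ℝ) : halfLine S ≤ volume S := Measure.restrict_apply_le _ _

lemma halfLine_Iic (t : ℝ) : halfLine (Iic t) = ENNReal.ofReal t := by
  rw [halfLine, Measure.restrict_apply measurableSet_Iic, Iic_inter_Ioi, Real.volume_Ioc, sub_zero]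

lemma measure_le_of_forall_measure_Iio_le {α : Type*} [LinearOrder α] [TopologicalSpace α]
    [OrderTopology α] [SecondCountableTopology α] [MeasurableSpace α] {ν : Measure α}
    [NullSingletonClass ν]
    {S : Set α} {M : ℝ≥0∞} (h : ∀ s ∈ S, ν (Iio s) ≤ M) : ν S ≤ M := by
  obtain ⟨T, hTS, hT, hTU⟩ :=
    TopologicalSpace.isOpen_biUnion_countable S Iio fun s _ => isOpen_Iio
  have hmax : (S \ ⋃ s ∈ S, Iio s).Subsingleton := fun x hx y hy => by
    by_contra hxy
    rcases lt_or_gt_of_ne hxy with hlt | hlt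
    · exact hx.2 (mem_biUnion hy.1 hlt)
    · exact hy.2 (mem_biUnion hx.1 hlt)
  calc ν S ≤ ν (⋃ s ∈ S, Iio s) + ν (S \ ⋃ s ∈ S, Iio s) :=
        measure_le_inter_add_sdiff _ _ _ |>.trans (by gcongr; exact inter_subset_right)
    _ = ν (⋃ s ∈ T, Iio s) := by rw [hmax.measure_zero, add_zero, hTU]
    _ = ⨆ s ∈ T, ν (Iio s) := measure_biUnion_eq_iSup hT fun s hs t ht => by
        rcases le_total s t with hst | hst
        · exact ⟨t, ht, Iio_subset_Iio hst, subset_rfl⟩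
        · exact ⟨s, hs, subset_rfl, Iio_subset_Iio hst⟩
    _ ≤ M := iSup₂_le fun s hs => h s (hTS hs)

lemma measure_le_of_forall_measure_Ioi_le {α : Type*} [LinearOrder α] [TopologicalSpace α]
    [OrderTopology α] [SecondCountableTopology α] [MeasurableSpace α] {ν : Measure α}
    [NullSingletonClass ν]
    {S : Set α} {M : ℝ≥0∞} (h : ∀ s ∈ S, ν (Ioi s) ≤ M) : ν S ≤ M := by
  have : @NullSingletonClass αᵒᵈ _ ν := ⟨fun x : α => measure_singleton (μ := ν) x⟩
  exact measure_le_of_forall_measure_Iio_le (α := αᵒᵈ) (ν := ν) (S := S) h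

variable {Ω : Type*} [MeasurableSpace Ω] {m : Measure Ω} {F G : Ω → ℝ≥0∞} {A : Set ℝ} {κ : ℝ≥0∞}

lemma setLIntegral_decrRearr_le_of_forall_Ioo (hA : MeasurableSet A) {M : ℝ≥0∞}
    (h : ∀ s ∈ A, rearrInt m G (Ioo 0 s) ≤ M) : ∫⁻ s in A, decrRearr m G s ∂halfLine ≤ M := by
  rw [← withDensity_apply _ hA]
  refine measure_le_of_forall_measure_Iio_le fun s hs => ?_
  rw [withDensity_apply _ measurableSet_Iio, setLIntegral_halfLine measurableSet_Iio, inter_comm,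
    Ioi_inter_Iio]
  exact h s hs

lemma setLIntegral_decrRearr_le_of_forall_Ioi (hA : MeasurableSet A) (hA0 : A ⊆ Ioi 0) {M : ℝ≥0∞}
    (h : ∀ s ∈ A, rearrInt m G (Ioi s) ≤ M) : ∫⁻ s in A, decrRearr m G s ∂halfLine ≤ M := by
  rw [← withDensity_apply _ hA]
  refine measure_le_of_forall_measure_Ioi_le fun s hs => ?_
  rw [withDensity_apply _ measurableSet_Ioi, setLIntegral_halfLine measurableSet_Ioi,
    inter_eq_left.2 (Ioi_subset_Ioi (le_of_lt (hA0 hs)))]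
  exact h s hs

lemma mul_decrRearr_le_of_rearrInt_Ioo_le {s t : ℝ} (ht : 0 < t) (hts : t ≤ s)
    (h : rearrInt m G (Ioo 0 s) ≤ κ * rearrInt m F (Ioo 0 s)) :
    ENNReal.ofReal t * decrRearr m G s ≤ κ * rearrInt m F (Ioo 0 t) := by
  have hs := ENNReal.ofReal_pos.2 (ht.trans_le hts)
  rw [← ENNReal.mul_le_mul_iff_right hs.ne' ENNReal.ofReal_ne_top]
  calc ENNReal.ofReal s * (ENNReal.ofReal t * decrRearr m G s)
      = ENNReal.ofReal t * (ENNReal.ofReal s * decrRearr m G s) := mul_left_comm _ _ _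
    _ ≤ ENNReal.ofReal t * (κ * rearrInt m F (Ioo 0 s)) := by
        gcongr _ * ?_
        exact (mul_decrRearr_le_rearrInt_Ioo s).trans h
    _ = κ * (ENNReal.ofReal t * rearrInt m F (Ioo 0 s)) := mul_left_comm _ _ _
    _ ≤ κ * (ENNReal.ofReal s * rearrInt m F (Ioo 0 t)) := by
        gcongr κ * ?_
        exact mul_rearrInt_Ioo_le_mul_rearrInt_Ioo hts
    _ = ENNReal.ofReal s * (κ * rearrInt m F (Ioo 0 t)) := mul_left_comm _ _ _

lemma rearrInt_Ioo_indicator_decrRearr_le (hA : MeasurableSet A)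
    (h : ∀ s ∈ A, 0 < s → rearrInt m G (Ioo 0 s) ≤ κ * rearrInt m F (Ioo 0 s)) {t : ℝ}
    (ht : 0 < t) :
    rearrInt halfLine (A.indicator (decrRearr m G)) (Ioo 0 t) ≤
      2 * κ * rearrInt m F (Ioo 0 t) := by
  let c := κ * rearrInt m F (Ioo 0 t) / ENNReal.ofReal t
  have ht' := (ENNReal.ofReal_pos.2 ht).ne'
  have hAt := hA.inter (measurableSet_Ioo (a := 0) (b := t))
  have hlow : ∫⁻ s in A ∩ Ioo 0 t, decrRearr m G s ∂halfLine ≤ κ * rearrInt m F (Ioo 0 t) :=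
    setLIntegral_decrRearr_le_of_forall_Ioo hAt fun s hs => (h s hs.1 hs.2.1).trans <| by
      gcongr
      exact rearrInt_mono_set (Ioo_subset_Ioo_right hs.2.2.le)
  have hhigh : ∀ᵐ s ∂halfLine,
      A.indicator (decrRearr m G) s - c ≤ (A ∩ Ioo 0 t).indicator (decrRearr m G) s := by
    filter_upwards [ae_restrict_mem measurableSet_Ioi] with s hs
    by_cases hsA : s ∈ A
    · rw [indicator_of_mem hsA]
      rcases lt_or_ge s t with hst | hts
      · rw [indicator_of_mem (mem_inter hsA (mem_Ioo.2 ⟨hs, hst⟩))]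
        exact tsub_le_self
      · refine (tsub_eq_zero_of_le ?_).trans_le zero_le
        rw [ENNReal.le_div_iff_mul_le (Or.inl ht') (Or.inl ENNReal.ofReal_ne_top), mul_comm]
        exact mul_decrRearr_le_of_rearrInt_Ioo_le ht hts (h s hsA hs)
    · rw [indicator_of_notMem hsA, zero_tsub]
      exact zero_le
  calc rearrInt halfLine (A.indicator (decrRearr m G)) (Ioo 0 t)
      ≤ ∫⁻ s, (A.indicator (decrRearr m G) s - c) ∂halfLine + ENNReal.ofReal t * c :=
        rearrInt_Ioo_le_add (measurable_decrRearr.indicator hA) c t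
    _ ≤ ∫⁻ s in A ∩ Ioo 0 t, decrRearr m G s ∂halfLine + κ * rearrInt m F (Ioo 0 t) := by
        rw [ENNReal.mul_div_cancel ht' ENNReal.ofReal_ne_top, ← lintegral_indicator hAt]
        gcongr 1
        exact lintegral_mono_ae hhigh
    _ ≤ _ := by
        rw [mul_assoc, two_mul]
        gcongr

lemma rearrInt_Ioi_indicator_decrRearr_le (hA : MeasurableSet A)
    (h : ∀ s ∈ A, 0 < s → rearrInt m G (Ioi s) ≤ κ * rearrInt m F (Ioi s)) {t : ℝ} (ht : 0 < t) :
    rearrInt halfLine (A.indicator (decrRearr m G)) (Ioi t) ≤ κ * rearrInt m F (Ioi t) := by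
  refine (rearrInt_Ioi_le (measurable_decrRearr.indicator hA) measurableSet_Iic ht.le
    (halfLine_Iic t).le).trans ?_
  rw [compl_Iic, setLIntegral_indicator hA]
  refine setLIntegral_decrRearr_le_of_forall_Ioi (hA.inter measurableSet_Ioi)
    (inter_subset_right.trans (Ioi_subset_Ioi ht.le)) fun s hs => ?_
  refine (h s hs.1 (ht.trans hs.2)).trans ?_
  gcongr
  exact rearrInt_mono_set (Ioi_subset_Ioi (le_of_lt hs.2))

lemma rearrInt_Ioi_indicator_decrRearr_le_rearrInt_Ioi (hA : MeasurableSet A) {s t : ℝ}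
    (hs : 0 ≤ s) (hAt : volume (A ∩ Ioc 0 t) ≤ ENNReal.ofReal s) :
    rearrInt halfLine (A.indicator (decrRearr m G)) (Ioi s) ≤ rearrInt m G (Ioi t) := by
  have hD : MeasurableSet (A ∩ Ioc 0 t) := hA.inter measurableSet_Ioc
  refine (rearrInt_Ioi_le (measurable_decrRearr.indicator hA) hD hs
    ((halfLine_apply_le _).trans hAt)).trans ?_
  rw [setLIntegral_indicator hA, setLIntegral_halfLine (hA.inter hD.compl)]
  refine lintegral_mono_set fun x hx => ?_
  by_contra hxt
  exact hx.1.2 ⟨hx.1.1, hx.2, not_lt.1 hxt⟩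

end HalfLine

section Rearranged

variable {Ω : Type*} [MeasurableSpace Ω] {m : Measure Ω} {𝕜 : Type*} [RCLike 𝕜]

/-- The decreasing rearrangement of `|g|` as a function on the half-line with values in `𝕜`. It is
meaningful when the rearrangement is finite on `(0, ∞)`, since `∞` is sent to `0`. -/
def rearrFun (g : Ω →ₘ[m] 𝕜) : ℝ →ₘ[halfLine] 𝕜 :=
  AEEqFun.mk (fun t => ((decrRearr m (fun x => ‖g x‖ₑ) t).toReal : 𝕜))
    (RCLike.continuous_ofReal.measurable.comp
      measurable_decrRearr.ennreal_toReal).aestronglyMeasurable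

variable {g : Ω →ₘ[m] 𝕜} {r : ℝ}

lemma ePow_rearrFun (hg : ∀ t, 0 < t → decrRearr m (fun x => ‖g x‖ₑ) t < ∞) (hr : 0 < r) :
    ePow (rearrFun g) r =ᵐ[halfLine] decrRearr m (ePow g r) := by
  have hmk : rearrFun g =ᵐ[halfLine] fun t => ((decrRearr m (fun x => ‖g x‖ₑ) t).toReal : 𝕜) :=
    AEEqFun.coeFn_mk _ _
  filter_upwards [hmk, ae_restrict_mem measurableSet_Ioi] with t hmk ht
  rw [ePow, hmk, decrRearr_ePow g hr, ← ofReal_norm, RCLike.norm_ofReal,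
    abs_of_nonneg ENNReal.toReal_nonneg, ENNReal.ofReal_toReal (hg t ht).ne]

lemma rearrInt_ePow_rearrFun (hg : ∀ t, 0 < t → decrRearr m (fun x => ‖g x‖ₑ) t < ∞)
    (hr : 0 < r) (I : Set ℝ) :
    rearrInt halfLine (ePow (rearrFun g) r) I = rearrInt m (ePow g r) I := by
  rw [rearrInt_congr (ePow_rearrFun hg hr), rearrInt_decrRearr]

lemma ePow_cut_rearrFun (hg : ∀ t, 0 < t → decrRearr m (fun x => ‖g x‖ₑ) t < ∞) (hr : 0 < r)
    {A : Set ℝ} (hA : MeasurableSet A) :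
    ePow (cut (rearrFun g) hA) r =ᵐ[halfLine] A.indicator (decrRearr m (ePow g r)) := by
  filter_upwards [ePow_cut (rearrFun g) hA hr, ePow_rearrFun hg hr] with t hcut hrearr
  rw [hcut]
  by_cases ht : t ∈ A <;> simp only [ht, indicator_of_mem, indicator_of_notMem, hrearr,
    not_false_eq_true]

variable {E : QuasiBanachFunctionSpace 𝕜 halfLine} {J : ℝ → Set ℝ} {g : ℝ →ₘ[halfLine] 𝕜}

lemma MajStable.exists_bound_of_cut_rearrFun (hstab : MajStable E J r) (hr : 0 < r)
    (hfin : ∃ T, 0 < T ∧ ∀ f ∈ E.carrier, rearrInt halfLine (ePow f r) (J T) < ∞) :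
    ∃ K : ℝ, 0 ≤ K ∧ ∀ (g : ℝ →ₘ[halfLine] 𝕜) {A : Set ℝ} (hA : MeasurableSet A),
      (∀ t, 0 < t → decrRearr halfLine (fun x => ‖g x‖ₑ) t < ∞) →
      cut (rearrFun g) hA ∈ E.carrier → cut (rearrFun g) hA.compl ∈ E.carrier →
      g ∈ E.carrier ∧
        E.nrm g ≤ K * (E.nrm (cut (rearrFun g) hA) + E.nrm (cut (rearrFun g) hA.compl)) := by
  obtain ⟨c, hc, hbound⟩ := hstab.exists_bound hr hfin ENNReal.one_ne_top
  obtain ⟨K, hK, hcut⟩ := exists_nrm_le_mul_cut_add_cut_compl E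
  refine ⟨c * K, by positivity, fun g A hA hg h₁ h₂ => ?_⟩
  obtain ⟨hmem, hnrm⟩ := hcut (rearrFun g) hA h₁ h₂
  obtain ⟨hgE, hgnrm⟩ := hbound _ hmem g fun t _ => by
    rw [rearrInt_ePow_rearrFun hg hr, one_mul]
  refine ⟨hgE, hgnrm.trans ?_⟩
  rw [mul_assoc]
  gcongr

lemma decrRearr_enorm_lt_top_of_forall_rearrInt_le {p q : ℝ} (hp : 0 < p) (hq : 0 < q)
    {f : ℝ →ₘ[halfLine] 𝕜} {κ₁ κ₂ : ℝ≥0∞} (hκ₁ : κ₁ ≠ ∞) (hκ₂ : κ₂ ≠ ∞) {T : ℝ} (hT : 0 < T)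
    (hhead : rearrInt halfLine (ePow f p) (Ioo 0 T) < ∞)
    (htail : rearrInt halfLine (ePow f q) (Ioi T) < ∞)
    (h : rearrInt halfLine (ePow g q) (Ioi T) ≤ κ₂ * rearrInt halfLine (ePow f q) (Ioi T) ∨
      rearrInt halfLine (ePow g p) (Ioo 0 T) ≤ κ₁ * rearrInt halfLine (ePow f p) (Ioo 0 T))
    {t : ℝ} (ht : 0 < t) : decrRearr halfLine (fun x => ‖g x‖ₑ) t < ∞ := by
  rcases h with h | h
  · exact decrRearr_enorm_lt_top_of_rearrInt_Ioi hq hT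
      (h.trans_lt (ENNReal.mul_lt_top hκ₂.lt_top htail)) ht
  · exact decrRearr_lt_top (measurable_enorm_coe g) (fun x => enorm_ne_top)
      (decrRearr_enorm_lt_top_of_rearrInt_Ioo hp hT
        (h.trans_lt (ENNReal.mul_lt_top hκ₁.lt_top hhead))) ht

/-- The rearrangement of `g` is cut along the set of those `u` where the head alternative holds:
the part on this set is controlled by head majorization, the rest by tail majorization. -/
lemma exists_bound_of_rearrInt_Ioi_le_or_rearrInt_Ioo_le {p q : ℝ} (hp : 0 < p) (hq : 0 < q)
    (hhead : MajStable E (Ioo 0) p) (htail : MajStable E Ioi q) (hE : E.carrier ≠ ⊥)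
    {κ₁ κ₂ : ℝ≥0∞} (hκ₁ : κ₁ ≠ ∞) (hκ₂ : κ₂ ≠ ∞) :
    ∃ c : ℝ, ∀ f ∈ E.carrier, ∀ g : ℝ →ₘ[halfLine] 𝕜,
      (∀ u, 0 < u →
        rearrInt halfLine (ePow g q) (Ioi u) ≤ κ₂ * rearrInt halfLine (ePow f q) (Ioi u) ∨
        rearrInt halfLine (ePow g p) (Ioo 0 u) ≤ κ₁ * rearrInt halfLine (ePow f p) (Ioo 0 u)) →
      g ∈ E.carrier ∧ E.nrm g ≤ c * E.nrm f := by
  obtain ⟨S, hS, hSfin⟩ := hhead.exists_rearrInt_Ioo_lt_top hE hp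
  obtain ⟨T, hT, hTfin⟩ := htail.exists_rearrInt_Ioi_lt_top hE hq
  obtain ⟨c₁, -, hbound₁⟩ := hhead.exists_bound hp ⟨S, hS, hSfin⟩ (κ := 2 * κ₁)
    (ENNReal.mul_ne_top ENNReal.ofNat_ne_top hκ₁)
  obtain ⟨c₂, -, hbound₂⟩ := htail.exists_bound hq ⟨T, hT, hTfin⟩ hκ₂
  obtain ⟨K, hK, hcut⟩ := hhead.exists_bound_of_cut_rearrFun hp ⟨S, hS, hSfin⟩
  refine ⟨K * (c₁ + c₂), fun f hf g hgf => ?_⟩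
  have hfin (t : ℝ) (ht : 0 < t) := decrRearr_enorm_lt_top_of_forall_rearrInt_le hp hq hκ₁ hκ₂ hT
    (rearrInt_Ioo_lt_top hS (hSfin f hf) T) (hTfin f hf) (hgf T hT) ht
  have hmono (h : ℝ →ₘ[halfLine] 𝕜) : Monotone fun u => rearrInt halfLine (ePow h p) (Ioo 0 u) :=
    fun u v huv => rearrInt_mono_set (Ioo_subset_Ioo_right huv)
  have hA : MeasurableSet {u | rearrInt halfLine (ePow g p) (Ioo 0 u) ≤
      κ₁ * rearrInt halfLine (ePow f p) (Ioo 0 u)} :=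
    measurableSet_le (hmono g).measurable ((hmono f).measurable.const_mul κ₁)
  obtain ⟨hmem₁, hnrm₁⟩ := hbound₁ f hf (cut (rearrFun g) hA) fun t ht => by
    rw [rearrInt_congr (ePow_cut_rearrFun hfin hp hA)]
    exact rearrInt_Ioo_indicator_decrRearr_le hA (fun u hu _ => hu) ht
  obtain ⟨hmem₂, hnrm₂⟩ := hbound₂ f hf (cut (rearrFun g) hA.compl) fun t ht => by
    rw [rearrInt_congr (ePow_cut_rearrFun hfin hq hA.compl)]
    exact rearrInt_Ioi_indicator_decrRearr_le hA.compl
      (fun u hu hu0 => (hgf u hu0).resolve_right hu) ht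
  obtain ⟨hmem, hnrm⟩ := hcut g hA hfin hmem₁ hmem₂
  refine ⟨hmem, hnrm.trans ?_⟩
  rw [mul_assoc, add_mul]
  gcongr

end Rearranged

section Dilation

lemma volume_inter_Ioc_eq_two_mul {D : Set ℝ} (h : ∀ x, 0 < x → (2 * x ∈ D ↔ x ∉ D)) (x : ℝ) :
    volume (D ∩ Ioc 0 x) = 2 * volume (Ioc 0 (x / 2) \ D) := by
  have hpre : (2 * ·) ⁻¹' (D ∩ Ioc 0 x) = Ioc 0 (x / 2) \ D := by
    ext y
    simp only [mem_preimage, mem_inter_iff, mem_Ioc, Set.mem_sdiff]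
    constructor
    · rintro ⟨hyD, hy0, hyx⟩
      have hy : 0 < y := by linarith
      exact ⟨⟨hy, by linarith⟩, (h y hy).1 hyD⟩
    · rintro ⟨⟨hy, hyx⟩, hyD⟩
      exact ⟨(h y hy).2 hyD, by linarith, by linarith⟩
  rw [← hpre, Real.volume_preimage_mul_left two_ne_zero, ← mul_assoc, abs_of_pos (by norm_num),
    ENNReal.ofReal_inv_of_pos two_pos, ENNReal.ofReal_ofNat,
    ENNReal.mul_inv_cancel two_ne_zero ENNReal.ofNat_ne_top, one_mul]

lemma volume_inter_Ioc_le {D : Set ℝ} (hD : MeasurableSet D)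
    (h : ∀ x, 0 < x → (2 * x ∈ D ↔ x ∉ D)) (x : ℝ) :
    volume (D ∩ Ioc 0 x) ≤ ENNReal.ofReal (2 / 3 * x) := by
  have hsub : D ∩ Ioc 0 x ⊆ D ∩ Ioc 0 (x / 2) ∪ Ioc (x / 2) x := fun y ⟨hyD, hy0, hyx⟩ =>
    (le_or_gt y (x / 2)).imp (fun hy => ⟨hyD, hy0, hy⟩) fun hy => ⟨hy, hyx⟩
  have hle : volume (D ∩ Ioc 0 x) ≤ volume (D ∩ Ioc 0 (x / 2)) + ENNReal.ofReal (x / 2) := by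
    refine (measure_mono hsub).trans ((measure_union_le _ _).trans_eq ?_)
    rw [Real.volume_Ioc, sub_half]
  have hsplit : volume (D ∩ Ioc 0 (x / 2)) + volume (Ioc 0 (x / 2) \ D) =
      ENNReal.ofReal (x / 2) := by
    rw [inter_comm, measure_inter_add_sdiff _ hD, Real.volume_Ioc, sub_zero]
  have hthree : 3 * volume (D ∩ Ioc 0 x) ≤ 3 * ENNReal.ofReal (2 / 3 * x) :=
    calc 3 * volume (D ∩ Ioc 0 x) = 2 * volume (D ∩ Ioc 0 x) + volume (D ∩ Ioc 0 x) := by ring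
      _ ≤ 2 * (volume (D ∩ Ioc 0 (x / 2)) + ENNReal.ofReal (x / 2)) +
          2 * volume (Ioc 0 (x / 2) \ D) := by
        rw [← volume_inter_Ioc_eq_two_mul h]
        gcongr
      _ = 2 * (volume (D ∩ Ioc 0 (x / 2)) + volume (Ioc 0 (x / 2) \ D)) +
          2 * ENNReal.ofReal (x / 2) := by ring
      _ = 4 * ENNReal.ofReal (x / 2) := by
        rw [hsplit]
        ring
      _ = 3 * ENNReal.ofReal (2 / 3 * x) := by
        rw [← ENNReal.ofReal_ofNat 4, ← ENNReal.ofReal_ofNat 3, ← ENNReal.ofReal_mul (by norm_num),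
          ← ENNReal.ofReal_mul (by norm_num)]
        congr 1
        ring
  exact (ENNReal.mul_le_mul_iff_right (by norm_num) (by norm_num)).1 hthree

lemma exists_measurableSet_forall_volume_inter_Ioc_le :
    ∃ D : Set ℝ, MeasurableSet D ∧ ∀ x, volume (D ∩ Ioc 0 x) ≤ ENNReal.ofReal (2 / 3 * x) ∧
      volume (Dᶜ ∩ Ioc 0 x) ≤ ENNReal.ofReal (2 / 3 * x) := by
  let D : Set ℝ := {x | Even ⌊Real.logb 2 x⌋}
  have hD : MeasurableSet D :=
    (Int.measurable_floor.comp (Real.measurable_log.div_const _))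
      (MeasurableSet.of_discrete (s := {n : ℤ | Even n}))
  have hdouble (x : ℝ) (hx : 0 < x) : 2 * x ∈ D ↔ x ∉ D := by
    have hlog : Real.logb 2 (2 * x) = Real.logb 2 x + 1 := by
      rw [Real.logb_mul two_ne_zero hx.ne', Real.logb_self_eq_one one_lt_two, add_comm]
    simp only [D, mem_ofPred_eq, hlog, Int.floor_add_one, Int.even_add_one]
  exact ⟨D, hD, fun x => ⟨volume_inter_Ioc_le hD hdouble x,
    volume_inter_Ioc_le hD.compl (fun y hy => not_congr (hdouble y hy)) x⟩⟩

variable {𝕜 : Type*} [RCLike 𝕜] {E : QuasiBanachFunctionSpace 𝕜 halfLine} {q : ℝ} {κ : ℝ≥0∞}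

lemma MajStable.exists_bound_of_pow_dilation (hstab : MajStable E Ioi q) (hq : 0 < q)
    (hE : E.carrier ≠ ⊥) (hκ : κ ≠ ∞) (n : ℕ) :
    ∃ c : ℝ, 0 ≤ c ∧ ∀ f ∈ E.carrier, ∀ g : ℝ →ₘ[halfLine] 𝕜,
      (∀ u, 0 < u → rearrInt halfLine (ePow g q) (Ioi ((3 / 2) ^ n * u)) ≤
        κ * rearrInt halfLine (ePow f q) (Ioi u)) →
      g ∈ E.carrier ∧ E.nrm g ≤ c * E.nrm f := by
  obtain ⟨T, hT, hTfin⟩ := hstab.exists_rearrInt_Ioi_lt_top hE hq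
  induction n with
  | zero => simpa only [pow_zero, one_mul] using hstab.exists_bound hq ⟨T, hT, hTfin⟩ hκ
  | succ n ih =>
    obtain ⟨c, hc, ih⟩ := ih
    obtain ⟨K, hK, hcut⟩ := hstab.exists_bound_of_cut_rearrFun hq ⟨T, hT, hTfin⟩
    obtain ⟨D, hD, hdens⟩ := exists_measurableSet_forall_volume_inter_Ioc_le
    refine ⟨K * (c + c), by positivity, fun f hf g hgf => ?_⟩
    have hfin (t : ℝ) (ht : 0 < t) := decrRearr_enorm_lt_top_of_rearrInt_Ioi hq
      (by positivity) ((hgf T hT).trans_lt (ENNReal.mul_lt_top hκ.lt_top (hTfin f hf))) ht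
    have hpart {B : Set ℝ} (hB : MeasurableSet B)
        (hBdens : ∀ x, volume (B ∩ Ioc 0 x) ≤ ENNReal.ofReal (2 / 3 * x)) :
        cut (rearrFun g) hB ∈ E.carrier ∧ E.nrm (cut (rearrFun g) hB) ≤ c * E.nrm f := by
      refine ih f hf _ fun u hu => ?_
      rw [rearrInt_congr (ePow_cut_rearrFun hfin hq hB)]
      refine (rearrInt_Ioi_indicator_decrRearr_le_rearrInt_Ioi hB (by positivity)
        ((hBdens _).trans_eq ?_)).trans (hgf u hu)
      congr 1
      ring
    obtain ⟨hmem₁, hnrm₁⟩ := hpart hD fun x => (hdens x).1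
    obtain ⟨hmem₂, hnrm₂⟩ := hpart hD.compl fun x => (hdens x).2
    obtain ⟨hmem, hnrm⟩ := hcut g hD hfin hmem₁ hmem₂
    refine ⟨hmem, hnrm.trans ?_⟩
    rw [mul_assoc, add_mul]
    gcongr

lemma MajStable.exists_bound_of_dilation (hstab : MajStable E Ioi q) (hq : 0 < q)
    (hE : E.carrier ≠ ⊥) (hκ : κ ≠ ∞) (a : ℝ) :
    ∃ c : ℝ, ∀ f ∈ E.carrier, ∀ g : ℝ →ₘ[halfLine] 𝕜,
      (∀ u, 0 < u → rearrInt halfLine (ePow g q) (Ioi (a * u)) ≤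
        κ * rearrInt halfLine (ePow f q) (Ioi u)) →
      g ∈ E.carrier ∧ E.nrm g ≤ c * E.nrm f := by
  obtain ⟨n, hn⟩ := pow_unbounded_of_one_lt a (y := (3 / 2 : ℝ)) (by norm_num)
  obtain ⟨c, -, hbound⟩ := hstab.exists_bound_of_pow_dilation hq hE hκ n
  refine ⟨c, fun f hf g hgf => hbound f hf g fun u hu => le_trans ?_ (hgf u hu)⟩
  exact rearrInt_mono_set (Ioi_subset_Ioi (by gcongr))

end Dilation

section MainResults

variable {Ω : Type*} [MeasurableSpace Ω] {m : Measure Ω} {𝕜 : Type*} [RCLike 𝕜] {p q : ℝ≥0∞}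

lemma rearrInt_Ioi_ePow_eq_zero [SFinite m] {g : Ω →ₘ[m] 𝕜} {r : ℝ} (hr : 0 < r) {t : ℝ}
    (ht : 0 ≤ t) (h : lGauge 0 g ≤ ENNReal.ofReal t) : rearrInt m (ePow g r) (Ioi t) = 0 := by
  have hsupp : MeasurableSet (Function.support g) :=
    (g.stronglyMeasurable.measurable (measurableSet_singleton 0)).compl
  refine nonpos_iff_eq_zero.1 ((rearrInt_Ioi_le (measurable_ePow g r) hsupp ht
    ((lGauge_zero g).symm.trans_le h)).trans_eq ?_)
  refine setLIntegral_eq_zero hsupp.compl fun x hx => ?_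
  simp [ePow, Function.notMem_support.1 hx, hr]

theorem MajStable.isInterpolationSpace_top [SigmaFinite m]
    {E : QuasiBanachFunctionSpace 𝕜 m} (hp0 : p ≠ 0) (hp : p ≠ ∞)
    (hstab : MajStable E (Ioo 0) p.toReal) (hE : E.carrier ≠ ⊥) : IsInterpolationSpace E p ∞ := by
  have hr := ENNReal.toReal_pos hp0 hp
  obtain ⟨T, hT, hfin⟩ := hstab.exists_rearrInt_Ioo_lt_top hE hr
  refine isInterpolationSpace_of_splitDominated (hstab.lSpace_inf_top_le hp0 hp hE)
    (fun f hf => mem_sup_top_of_rearrInt_Ioo_lt_top hp0 hp hT (hfin f hf)) fun K _ => ?_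
  obtain ⟨c, -, hc⟩ := hstab.exists_bound hr ⟨T, hT, hfin⟩
    (κ := 2 ^ p.toReal * (2 * (K : ℝ≥0∞) ^ p.toReal)) (by finiteness)
  exact ⟨c, fun f hf g hfg => hc f hf g fun u hu =>
    hfg.rearrInt_Ioo_le_of_top hp0 hp hu (rearrInt_Ioo_lt_top hT (hfin f hf) u)⟩

variable {E : QuasiBanachFunctionSpace 𝕜 halfLine}

lemma MajStable.lSpace_zero_inf_le (hq0 : q ≠ 0) (hq : q ≠ ∞)
    (hstab : MajStable E Ioi q.toReal) (hE : E.carrier ≠ ⊥) :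
    lSpace 𝕜 halfLine 0 ⊓ lSpace 𝕜 halfLine q ≤ E.carrier := by
  rintro g ⟨hg0, hgq⟩
  obtain ⟨A, hA, hA0, hAt, hmem, -⟩ := exists_cut_one_mem hE
  have hr := ENNReal.toReal_pos hq0 hq
  have hint : ∫⁻ x, ePow g q.toReal x ∂halfLine ≠ ∞ :=
    ((mem_lSpace_iff_lintegral hq0 hq).1 hgq).ne
  set α := (halfLine A).toReal / 2
  have hα : 0 < α := half_pos (ENNReal.toReal_pos hA0 hAt)
  have hα0 : ENNReal.ofReal α ≠ 0 := (ENNReal.ofReal_pos.2 hα).ne'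
  have hAα : halfLine A = ENNReal.ofReal α + ENNReal.ofReal α := by
    rw [← ENNReal.ofReal_add hα.le hα.le, add_halves, ENNReal.ofReal_toReal hAt]
  obtain ⟨c, hc⟩ := hstab.exists_bound_of_dilation hr hE (ENNReal.div_ne_top hint hα0)
    ((lGauge 0 g).toReal / α)
  refine (hc _ hmem g fun u hu => ?_).1
  rcases le_total α u with hαu | huα
  · refine (rearrInt_Ioi_ePow_eq_zero hr (by positivity) ?_).trans_le zero_le
    rw [ENNReal.le_ofReal_iff_toReal_le (mem_lSpace_iff.1 hg0).ne (by positivity),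
      div_mul_eq_mul_div, le_div_iff₀ hα]
    gcongr
  · rw [rearrInt_cut_one hA hr, rearrInt_Ioi_indicator_const A 1 hu.le, one_mul]
    calc rearrInt halfLine (ePow g q.toReal) (Ioi ((lGauge 0 g).toReal / α * u))
        ≤ ∫⁻ x, ePow g q.toReal x ∂halfLine :=
          rearrInt_le_lintegral (measurable_ePow g _) (Ioi_subset_Ioi (by positivity))
      _ = (∫⁻ x, ePow g q.toReal x ∂halfLine) / ENNReal.ofReal α * ENNReal.ofReal α :=
          (ENNReal.div_mul_cancel hα0 ENNReal.ofReal_ne_top).symm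
      _ ≤ (∫⁻ x, ePow g q.toReal x ∂halfLine) / ENNReal.ofReal α *
            (halfLine A - ENNReal.ofReal u) := by
          gcongr
          rw [hAα]
          exact ENNReal.le_sub_of_add_le_left ENNReal.ofReal_ne_top (by gcongr)

theorem MajStable.isInterpolationSpace_zero (hq0 : q ≠ 0) (hq : q ≠ ∞)
    (hstab : MajStable E Ioi q.toReal) (hE : E.carrier ≠ ⊥) : IsInterpolationSpace E 0 q := by
  have hr := ENNReal.toReal_pos hq0 hq
  obtain ⟨T, hT, hfin⟩ := hstab.exists_rearrInt_Ioi_lt_top hE hr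
  refine isInterpolationSpace_of_splitDominated (hstab.lSpace_zero_inf_le hq0 hq hE)
    (fun f hf => mem_zero_sup_of_rearrInt_Ioi_lt_top hq0 hq hT (hfin f hf)) fun K hK => ?_
  obtain ⟨c, hc⟩ := hstab.exists_bound_of_dilation hr hE (a := K * 2)
    (κ := 2 ^ q.toReal * (2 * (K : ℝ≥0∞) ^ q.toReal)) (by finiteness)
  refine ⟨c, fun f hf g hfg => hc f hf g fun u hu => ?_⟩
  rw [mul_assoc]
  exact hfg.rearrInt_Ioi_le_of_zero hq0 hq hK hu

theorem MajStable.isInterpolationSpace (hp0 : p ≠ 0) (hpq : p < q) (hq : q ≠ ∞)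
    (hhead : MajStable E (Ioo 0) p.toReal) (htail : MajStable E Ioi q.toReal)
    (hE : E.carrier ≠ ⊥) : IsInterpolationSpace E p q := by
  have hP := ENNReal.toReal_pos hp0 hpq.ne_top
  have hQ := ENNReal.toReal_pos hpq.ne_bot hq
  obtain ⟨S, hS, hSfin⟩ := hhead.exists_rearrInt_Ioo_lt_top hE hP
  obtain ⟨T, hT, hTfin⟩ := htail.exists_rearrInt_Ioi_lt_top hE hQ
  refine isInterpolationSpace_of_splitDominated
    ((lSpace_inf_le_sup_inf_zero_inf_top hp0 hpq.ne_top).trans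
      (sup_le (htail.lSpace_zero_inf_le hpq.ne_bot hq hE)
        (hhead.lSpace_inf_top_le hp0 hpq.ne_top hE)))
    (fun f hf => mem_sup_of_rearrInt_lt_top hp0 hpq.ne_top hpq.ne_bot hq hS hT (hSfin f hf)
      (hTfin f hf)) fun K hK => ?_
  obtain ⟨c, hc⟩ := exists_bound_of_rearrInt_Ioi_le_or_rearrInt_Ioo_le hP hQ hhead htail hE
    (κ₁ := 2 ^ p.toReal * 4 * (K : ℝ≥0∞) ^ p.toReal)
    (κ₂ := 2 ^ q.toReal * (3 * (K : ℝ≥0∞) ^ q.toReal)) (by finiteness) (by finiteness)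
  exact ⟨c, fun f hf g hfg => hc f hf g fun u hu =>
    hfg.rearrInt_Ioi_le_or_rearrInt_Ioo_le hp0 hpq hq hK hu
      (rearrInt_Ioo_lt_top hS (hSfin f hf) u)⟩

end MainResults

end

theorem mainTheorem5 {𝕜 : Type*} [RCLike 𝕜] (p q : ℝ≥0∞) (hpq : p < q)
    (hend : p ≠ 0 ∨ q ≠ ∞) (E : QuasiBanachFunctionSpace 𝕜 halfLine)
    (hE : E.carrier ≠ ⊥)
    (hhead : p ≠ 0 → ∃ c : ℝ, 0 < c ∧
      ∀ f ∈ E.carrier, ∀ g ∈ lSpace 𝕜 halfLine p ⊔ lSpace 𝕜 halfLine ∞,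
        HeadMaj (absPow g p.toReal) (absPow f p.toReal) →
          g ∈ E.carrier ∧ E.nrm g ≤ c * E.nrm f)
    (htail : q ≠ ∞ → ∃ c : ℝ, 0 < c ∧
      ∀ f ∈ E.carrier, ∀ g ∈ lSpace 𝕜 halfLine 0 ⊔ lSpace 𝕜 halfLine q,
        TailMaj (absPow g q.toReal) (absPow f q.toReal) →
          g ∈ E.carrier ∧ E.nrm g ≤ c * E.nrm f) :
    IsInterpolationSpace E p q := by
  have hq0 : q ≠ 0 := hpq.ne_bot
  have hheadStable (hp0 : p ≠ 0) : MajStable E (Ioo 0) p.toReal :=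
    majStable_of_headMaj hp0 hpq.ne_top (hhead hp0)
  have htailStable (hq : q ≠ ∞) : MajStable E Ioi q.toReal :=
    majStable_of_tailMaj hq0 hq (htail hq)
  rcases eq_or_ne p 0 with rfl | hp0
  · have hq := hend.resolve_left (not_not_intro rfl)
    exact (htailStable hq).isInterpolationSpace_zero hq0 hq hE
  rcases eq_or_ne q ∞ with rfl | hq
  · exact (hheadStable hp0).isInterpolationSpace_top hp0 hpq.ne_top hE
  · exact (hheadStable hp0).isInterpolationSpace hp0 hpq hq (htailStable hq) hE
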